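/- Let $\mathcal X\subseteq\mathbb R^N$ and $\mathcal Z_m\subseteq\mathbb R^{J_m}$ ($m=1,\dots,M$) be non-empty, compact and convex. Let $f_0:\mathbb R^N\to\mathbb R\cup\{+\infty\}$ be convex and finite on $\mathcal X$. Let $g_m:\mathbb R^N\times\mathbb R^{J_m}\to\mathbb R\cup\{\pm\infty\}$ be finite on $\mathcal X\times\mathcal Z_m$, with $g_m(\cdot,z_m)$ convex for every $z_m\in\mathcal Z_m$ and $g_m(x,\cdot)$ concave for every $x\in\mathcal X$. Put $f_m(x)=\max_{z_m\in\mathcal Z_m}g_m(x,z_m)$ and consider the robust problem $$\min\{f_0(x): x\in\mathcal X,\ f_m(x)\le 0\ \text{for all } m\}.$$ Assume that it has an optimal solution $x^\star$ and that there is a Slater point $\bar x\in\mathcal X$ with $f_m(\bar x)<0$ for all $m$. Assume further that for all $x\in\mathcal X$, $z_m\in\mathcal Z_m$ the subdifferentials $\partial f_0(x)$, $\partial_x g_m(x,z_m)$, $\partial_{z_m}(-g_m)(x,z_m)$ are non-empty and that their elements have Euclidean norm at most $D_0$, $D_m$, $B_m$ respectively, where the constants $D_0,D_m,B_m>0$ do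 not depend on $x,z_m$. A point $x\in\mathcal X$ is called $\varepsilon$-approximate optimal if $f_0(x)-f_0(x^\star)\le\varepsilon$ and $\max_m\max\{f_m(x),0\}\le\varepsilon$. The algorithm ProM$^3$ with parameters $K,T\ge1$ and $\alpha,\beta,\gamma,\delta,\theta,\nu>0$ is the following. *Outer algorithm.* Start with $\lambda^0=0$ and any $x^0\in\mathcal X$. For $k=0,\dots,K-1$: find $z^k_m\in\mathcal Z_m$ with $f_m(x^k)-g_m(x^k,z_m^k)\le\theta$ for each $m$; with $g^k=(g_m(x^k,z^k_m))_m$ and $g^{-1}=g^0$, put $\lambda^{k+1}=\max\{\lambda^k+\beta(2g^k-g^{k-1}),0\}$ (componentwise). Let $(x^{k+1},\tilde z^{k+1})$ be the output of the inner algorithm for $(\lambda^{k+1},x^k)$. It is required to be a strong $\nu$-approximate saddle point of $F(x,z)=f_0(x)+\sum_m\lambda^{k+1}_m g_m(x,z_m)+\frac1{2\alpha}\|x-x^k\|^2$, that is, with $\mathcal Z=\mathcal Z_1\times\dots\times\mathcal Z_M$, $F(x^{k+1},v)\le F(u,\tilde z^{k+1})-\frac1{2\alpha}\|u-x^{k+1}\|^2+\nu$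 for all $u\in\mathcal X$, $v\in\mathcal Z$. Output $\frac1K\sum_{k=1}^Kx^k$. *Inner algorithm.* Start with any $x_0\in\mathcal X$, $z_0\in\mathcal Z$. For $t=0,\dots,T-1$: take $\zeta_{t,m}\in\partial_{z_m}(-g_m)(x_t,z_{t,m})$ (with $\zeta_{-1,m}=\zeta_{0,m}$) and put $z_{t+1,m}=\mathrm{Proj}_{\mathcal Z_m}\big(z_{t,m}-\delta\lambda^{k+1}_m(2\zeta_{t,m}-\zeta_{t-1,m})\big)$; take $\xi_{t,0}\in\partial f_0(x_t)$, $\xi_{t,m}\in\partial_xg_m(x_t,z_{t+1,m})$, put $\xi_t=\xi_{t,0}+\sum_m\lambda^{k+1}_m\xi_{t,m}$ and $x_{t+1}=\mathrm{Proj}_{\mathcal X}\big(\frac{\alpha\gamma}{\alpha+\gamma}(\frac1\alpha x^k+\frac1\gamma x_t-\xi_t)\big)$. Output $\frac1T\sum_{t=1}^T(x_t,z_t)$. **Theorem.** Let $\alpha,\beta>0$ with $\alpha\sqrt{\sum_mD_m^2}\le1$ and $2\beta\sqrt{\sum_mD_m^2}\le1$. There are constants $c_K,c_T,c_S,C>0$,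 depending only on the problem, on the constants $D_0,D_m,B_m$ and on $\alpha,\beta$, such that for every $\varepsilon>0$ the following holds for ProM$^3$ with $K=\lceil c_K/\varepsilon\rceil$, $\theta=\nu=1/K$, $T=\lceil c_TK^2\rceil$, $\gamma=\delta=1/\sqrt T$. For every $x^0\in\mathcal X$, all starting points of the inner algorithm, all subgradients returned by the oracles and all choices of the $z^k_m$, each step can be carried out, each inner output is a strong $\nu$-approximate saddle point as required, the output of ProM$^3$ is $\varepsilon$-approximate optimal, and the total number of calls to the subgradient oracles of $f_0,g_m$ and the projection oracles of $\mathcal X,\mathcal Z_m$, not counting the search for the $z^k_m$, is at most $C\max\{1,\varepsilon^{-3}\}$; in particular it is $\mathcal O(\varepsilon^{-3})$ as $\varepsilon\to0$. The same holds, with all calls counted, when $(z_m^k)_m$ is computed by averaging the points $w_{0,m},\dots,w_{S-1,m}$ visited by projected subgradient ascent $w_{j+1,m}=\mathrm{Proj}_{\mathcal Z_m}(w_{j,m}-S^{-1/2}\zeta_{j,m})$, $\zeta_{j,m}\in\partial_{z_m}(-g_m)(x^k,w_{j,m})$, with $S=\lceil c_SK^2\rceil$ and any $w_0\in\mathcal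 Z$. -/

import Mathlib

open scoped BigOperators

/-- Real `n`-space with the Euclidean norm. -/
abbrev Vec (n : ℕ) : Type := EuclideanSpace ℝ (Fin n)

/-! ### Extended-real-valued convex analysis -/

/-- Convexity of an extended-real-valued function: its epigraph is convex. -/
def EConvex {n : ℕ} (f : Vec n → EReal) : Prop :=
  Convex ℝ {p : Vec n × ℝ | f p.1 ≤ (p.2 : EReal)}

/-- The convex subdifferential `∂ f (x)`. -/
def subdiff {n : ℕ} (f : Vec n → EReal) (x : Vec n) : Set (Vec n) :=
  {ξ | ∀ y, f x + ((inner ℝ ξ (y - x) : ℝ) : EReal) ≤ f y}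

/-- `p` is the Euclidean projection of `y` onto `S`. -/
def IsProj {n : ℕ} (S : Set (Vec n)) (y p : Vec n) : Prop :=
  p ∈ S ∧ ∀ w ∈ S, ‖y - p‖ ≤ ‖y - w‖

/-! ### The robust problem and its assumptions -/

/-- Data of the robust problem: minimise `f0 x` over `x ∈ X` subject to
`max_{z ∈ Z m} g m x z ≤ 0` for all `m`. -/
structure RobustProblem (N M : ℕ) (J : Fin M → ℕ) where
  X : Set (Vec N)
  Z : (m : Fin M) → Set (Vec (J m))
  f0 : Vec N → EReal
  g : (m : Fin M) → Vec N → Vec (J m) → EReal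

namespace RobustProblem

variable {N M : ℕ} {J : Fin M → ℕ}

/-- The worst-case constraint function `f_m x = max_{z ∈ Z m} g m x z`. -/
noncomputable def worst (P : RobustProblem N M J) (m : Fin M) (x : Vec N) : EReal :=
  ⨆ z ∈ P.Z m, P.g m x z

def IsFeasible (P : RobustProblem N M J) (x : Vec N) : Prop :=
  x ∈ P.X ∧ ∀ m, P.worst m x ≤ 0

def IsOptimal (P : RobustProblem N M J) (x : Vec N) : Prop :=
  P.IsFeasible x ∧ ∀ y, P.IsFeasible y → P.f0 x ≤ P.f0 y

/-- Optimality gap at most `ε` and constraint violation `max_m [f_m x]_+` at most `ε`. -/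
def IsApproxOptimal (P : RobustProblem N M J) (ε : ℝ) (x : Vec N) : Prop :=
  x ∈ P.X ∧ (∃ xs, P.IsOptimal xs ∧ P.f0 x ≤ P.f0 xs + (ε : EReal)) ∧
    ∀ m, max (P.worst m x) 0 ≤ (ε : EReal)

/-- The standing assumptions of robust convex optimization. -/
structure Standing (P : RobustProblem N M J) : Prop where
  X_nonempty : P.X.Nonempty
  X_compact : IsCompact P.X
  X_convex : Convex ℝ P.X
  Z_nonempty : ∀ m, (P.Z m).Nonempty
  Z_compact : ∀ m, IsCompact (P.Z m)
  Z_convex : ∀ m, Convex ℝ (P.Z m)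
  f0_ne_bot : ∀ x, P.f0 x ≠ ⊥
  f0_finite : ∀ x ∈ P.X, P.f0 x ≠ ⊤
  f0_convex : EConvex P.f0
  g_finite : ∀ m, ∀ x ∈ P.X, ∀ z ∈ P.Z m, P.g m x z ≠ ⊥ ∧ P.g m x z ≠ ⊤
  g_convex : ∀ m, ∀ z ∈ P.Z m, EConvex (fun x => P.g m x z)
  g_concave : ∀ m, ∀ x ∈ P.X, EConvex (fun z => -P.g m x z)
  slater : ∃ x ∈ P.X, ∀ m, P.worst m x < 0
  optimum : ∃ x, P.IsOptimal x

/-- Subdifferentiability with uniformly bounded subdifferentials, with bounds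
`D0` for `∂ f0`, `D m` for `∂_x g m` and `B m` for `∂_z (-g m)`. -/
structure BoundedSubdiff (P : RobustProblem N M J) (D0 : ℝ) (D B : Fin M → ℝ) : Prop where
  D0_pos : 0 < D0
  D_pos : ∀ m, 0 < D m
  B_pos : ∀ m, 0 < B m
  f0_nonempty : ∀ x ∈ P.X, (subdiff P.f0 x).Nonempty
  gx_nonempty : ∀ m, ∀ x ∈ P.X, ∀ z ∈ P.Z m, (subdiff (fun x' => P.g m x' z) x).Nonempty
  gz_nonempty : ∀ m, ∀ x ∈ P.X, ∀ z ∈ P.Z m, (subdiff (fun z' => -P.g m x z') z).Nonempty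
  f0_bound : ∀ x ∈ P.X, ∀ ξ ∈ subdiff P.f0 x, ‖ξ‖ ≤ D0
  gx_bound : ∀ m, ∀ x ∈ P.X, ∀ z ∈ P.Z m, ∀ ξ ∈ subdiff (fun x' => P.g m x' z) x, ‖ξ‖ ≤ D m
  gz_bound : ∀ m, ∀ x ∈ P.X, ∀ z ∈ P.Z m, ∀ ζ ∈ subdiff (fun z' => -P.g m x z') z, ‖ζ‖ ≤ B m

/-- Every `z m` is a `θ`-approximate maximiser of `g m x` over `Z m`. -/
def IsApproxMaximiser (P : RobustProblem N M J) (θ : ℝ) (x : Vec N) (m : Fin M)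
    (z : Vec (J m)) : Prop :=
  z ∈ P.Z m ∧ P.worst m x ≤ P.g m x z + (θ : EReal)

/-- Objective of the inner saddle-point problem,
`f0 x + ∑ m, lam m * g m x (z m) + ‖x - xk‖² / (2 α)`; it is used only on `X × Z`, where
`f0` and `g` are finite. -/
noncomputable def innerObj (P : RobustProblem N M J) (α : ℝ) (lam : Fin M → ℝ) (xk : Vec N)
    (x : Vec N) (z : (m : Fin M) → Vec (J m)) : ℝ :=
  (P.f0 x).toReal + ∑ m, lam m * (P.g m x (z m)).toReal + 1 / (2 * α) * ‖x - xk‖ ^ 2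

/-- `(x, z)` is a strong `ν`-approximate saddle point of the inner problem, whose objective is
`1 / α`-strongly convex in `x`. -/
def IsStrongApproxSaddle (P : RobustProblem N M J) (α ν : ℝ) (lam : Fin M → ℝ) (xk : Vec N)
    (x : Vec N) (z : (m : Fin M) → Vec (J m)) : Prop :=
  x ∈ P.X ∧ (∀ m, z m ∈ P.Z m) ∧
    ∀ u ∈ P.X, ∀ v : (m : Fin M) → Vec (J m), (∀ m, v m ∈ P.Z m) →
      P.innerObj α lam xk x v ≤ P.innerObj α lam xk u z - (1 / α) / 2 * ‖u - x‖ ^ 2 + ν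

end RobustProblem

/-! ### Programs with oracle calls -/

/-- What a first-order method may ask for. The first five requests are the subgradient and
projection oracles. The last two are steps that an algorithm leaves unspecified: picking an
arbitrary `θ`-approximate maximiser, and picking an arbitrary starting point in `X × Z`. -/
inductive Request (N M : ℕ) (J : Fin M → ℕ) : Type
  | objSubgrad (x : Vec N)
  | conSubgrad (m : Fin M) (x : Vec N) (z : Vec (J m))
  | uncSubgrad (m : Fin M) (x : Vec N) (z : Vec (J m))
  | projX (y : Vec N)
  | projZ (m : Fin M) (y : Vec (J m))
  | pickMax (θ : ℝ) (m : Fin M) (x : Vec N)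
  | pickStart

namespace Request

variable {N M : ℕ} {J : Fin M → ℕ}

/-- The type of answers to a request. -/
abbrev Answer : Request N M J → Type
  | objSubgrad _ => Vec N
  | conSubgrad _ _ _ => Vec N
  | uncSubgrad m _ _ => Vec (J m)
  | projX _ => Vec N
  | projZ m _ => Vec (J m)
  | pickMax _ m _ => Vec (J m)
  | pickStart => Vec N × ((m : Fin M) → Vec (J m))

/-- The answers that are correct for the problem `P`. -/
def Valid (P : RobustProblem N M J) : (q : Request N M J) → q.Answer → Prop
  | objSubgrad x => fun ξ => ξ ∈ subdiff P.f0 x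
  | conSubgrad m x z => fun ξ => ξ ∈ subdiff (fun x' => P.g m x' z) x
  | uncSubgrad m x z => fun ζ => ζ ∈ subdiff (fun z' => -P.g m x z') z
  | projX y => fun p => IsProj P.X y p
  | projZ m y => fun p => IsProj (P.Z m) y p
  | pickMax θ m x => fun z => P.IsApproxMaximiser θ x m z
  | pickStart => fun s => s.1 ∈ P.X ∧ ∀ m, s.2 m ∈ P.Z m

/-- The number of subgradient and projection oracle calls in a request. -/
def calls : Request N M J → ℕ
  | objSubgrad _ => 1
  | conSubgrad _ _ _ => 1
  | uncSubgrad _ _ _ => 1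
  | projX _ => 1
  | projZ _ _ => 1
  | pickMax _ _ _ => 0
  | pickStart => 0

end Request

/-- Programs: return a value, issue `n` requests and continue with the answers, or claim that
`p` holds at this point and continue. -/
inductive Prog (N M : ℕ) (J : Fin M → ℕ) (R : Type) : Type
  | ret (r : R) : Prog N M J R
  | ask (n : ℕ) (q : Fin n → Request N M J)
      (k : ((i : Fin n) → (q i).Answer) → Prog N M J R) : Prog N M J R
  | check (p : Prop) (k : Prog N M J R) : Prog N M J R

namespace Prog

variable {N M : ℕ} {J : Fin M → ℕ} {R R' : Type}

/-- Sequential composition. -/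
def bind : Prog N M J R → (R → Prog N M J R') → Prog N M J R'
  | ret r, c => c r
  | ask n q k, c => ask n q fun a => (k a).bind c
  | check p k, c => check p (k.bind c)

/-- Total correctness with cost: every request issued has a correct answer, and for *all* choices
of correct answers every claim made on the way is true and the program ends with a result `r`
after a number `c` of oracle calls such that `post r c`. -/
def Ensures (P : RobustProblem N M J) : Prog N M J R → (R → ℕ → Prop) → Prop
  | ret r, post => post r 0
  | ask _ q k, post => (∀ i, ∃ a, (q i).Valid P a) ∧
      ∀ a, (∀ i, (q i).Valid P (a i)) →
        (k a).Ensures P fun r c => post r (∑ i, (q i).calls + c)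
  | check p k, post => p ∧ k.Ensures P post

end Prog

/-! ### The algorithm -/

section Algorithm

variable {N M : ℕ} {J : Fin M → ℕ}

/-- The remaining iterations of the inner algorithm, at the current iterate `(x, z)`, with the
previous subgradients `ζp` (`none` in the first iteration) and the sums `sx`, `sz` of the iterates
produced so far. -/
noncomputable def innerLoop (α γ δ : ℝ) (lam : Fin M → ℝ) (xk : Vec N) :
    ℕ → Vec N → ((m : Fin M) → Vec (J m)) → Option ((m : Fin M) → Vec (J m)) →
      Vec N → ((m : Fin M) → Vec (J m)) → Prog N M J (Vec N × ((m : Fin M) → Vec (J m)))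
  | 0, _, _, _, sx, sz => .ret (sx, sz)
  | t + 1, x, z, ζp, sx, sz =>
    .ask M (fun m => .uncSubgrad m x (z m)) fun ζ =>
    .ask M (fun m => .projZ m
      (z m - (δ * lam m) • ((2 : ℝ) • ζ m - (ζp.getD ζ) m))) fun z' =>
    .ask 1 (fun _ => .objSubgrad x) fun ξ0 =>
    .ask M (fun m => .conSubgrad m x (z' m)) fun ξ =>
    .ask 1 (fun _ => .projX
      ((α * γ / (α + γ)) •
        ((1 / α) • xk + (1 / γ) • x - (ξ0 0 + ∑ m, lam m • ξ m)))) fun x' =>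
    innerLoop α γ δ lam xk t (x' 0) z' (some ζ) (sx + x' 0) (fun m => sz m + z' m)

/-- The inner algorithm: `T` iterations from an arbitrary starting point of `X × Z`, returning the
averages of the iterates number `1, …, T`. -/
noncomputable def innerAlg (T : ℕ) (α γ δ : ℝ) (lam : Fin M → ℝ) (xk : Vec N) :
    Prog N M J (Vec N × ((m : Fin M) → Vec (J m))) :=
  .ask 1 (fun _ => .pickStart) fun s =>
    (innerLoop α γ δ lam xk T (s 0).1 (s 0).2 none 0 (fun _ => 0)).bind fun r =>
      .ret ((1 / (T : ℝ)) • r.1, fun m => (1 / (T : ℝ)) • r.2 m)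

/-- The maximisation step with the approximate maximisers given for free. -/
def findByPick (θ : ℝ) (x : Vec N) : Prog N M J ((m : Fin M) → Vec (J m)) :=
  .ask M (fun m => .pickMax θ m x) fun z => .ret z

/-- Projected subgradient ascent on every `g m x` over `Z m`, with the sums `sz` of the points
visited so far. -/
noncomputable def ascentLoop (s : ℝ) (x : Vec N) :
    ℕ → ((m : Fin M) → Vec (J m)) → ((m : Fin M) → Vec (J m)) →
      Prog N M J ((m : Fin M) → Vec (J m))
  | 0, _, sz => .ret sz
  | t + 1, z, sz =>
    .ask M (fun m => .uncSubgrad m x (z m)) fun ζ =>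
    .ask M (fun m => .projZ m (z m - s • ζ m)) fun z' =>
    ascentLoop s x t z' (fun m => sz m + z m)

/-- The maximisation step carried out by `S` iterations of projected subgradient ascent with step
size `s` from an arbitrary starting point, returning the average of the points visited. -/
noncomputable def findByAscent (S : ℕ) (s : ℝ) (x : Vec N) :
    Prog N M J ((m : Fin M) → Vec (J m)) :=
  .ask 1 (fun _ => .pickStart) fun st =>
    (ascentLoop s x S (st 0).2 (fun _ => 0)).bind fun sz =>
      .ret (fun m => (1 / (S : ℝ)) • sz m)

/-- The remaining iterations of the outer algorithm, at the current `x = x^k` and `lam = λ^k`, with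
the previous constraint values `gp` (`none` in the first iteration) and the sum `sx` of the iterates
produced so far. `find` computes the approximate maximisers `z^k`, `inner` performs the `x`-update.
The program claims that they meet the requirements of the outer algorithm. -/
noncomputable def outerLoop (P : RobustProblem N M J) (α β θ ν : ℝ)
    (find : Vec N → Prog N M J ((m : Fin M) → Vec (J m)))
    (inner : (Fin M → ℝ) → Vec N → Prog N M J (Vec N × ((m : Fin M) → Vec (J m)))) :
    ℕ → Vec N → (Fin M → ℝ) → Option (Fin M → ℝ) → Vec N → Prog N M J (Vec N)
  | 0, _, _, _, sx => .ret sx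
  | j + 1, x, lam, gp, sx =>
    (find x).bind fun z =>
    .check (∀ m, P.IsApproxMaximiser θ x m (z m)) <|
    let gz : Fin M → ℝ := fun m => (P.g m x (z m)).toReal
    let lam' : Fin M → ℝ := fun m => max (lam m + β * (2 * gz m - (gp.getD gz) m)) 0
    (inner lam' x).bind fun r =>
    .check (P.IsStrongApproxSaddle α ν lam' x r.1 r.2) <|
    outerLoop P α β θ ν find inner j r.1 lam' (some gz) (sx + r.1)

/-- The proximal max-min-max algorithm: `K` outer iterations from `λ^0 = 0` and `x^0 = x0`, each
`x`-update being done by `T` iterations of the inner algorithm; the result is the average of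
`x^1, …, x^K`. -/
noncomputable def proM3 (P : RobustProblem N M J) (α β θ ν : ℝ)
    (find : Vec N → Prog N M J ((m : Fin M) → Vec (J m)))
    (K T : ℕ) (γ δ : ℝ) (x0 : Vec N) : Prog N M J (Vec N) :=
  (outerLoop P α β θ ν find (innerAlg T α γ δ) K x0 (fun _ => 0) none 0).bind fun sx =>
    .ret ((1 / (K : ℝ)) • sx)

end Algorithm

/-!
Both loops are projected primal-dual methods whose dual step uses an extrapolated vector
`2 d_t - d_{t-1}`. One part of the resulting inner products with `d_t - d_{t-1}` telescopes; the
rest is at most `‖d_t - d_{t-1}‖` times the length of the dual step and is absorbed by the quadratic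
terms of the three-point inequality. In the inner loop, where `d_t - d_{t-1}` is merely bounded,
this leaves an error `O(γ + δ)` per iteration. In the outer loop `d_t` consists of constraint
values, so its change is controlled by the length of the primal step, and `2 α β ∑ D_m² ≤ 1` lets
the proximal term absorb it. Hence the sum of the gaps is bounded by the initial value of a
potential plus the accumulated errors, and convexity passes the bound on to the average iterate.

The number of inner iterations must not depend on the multipliers `λ^k`, so these have to be bounded
independently of `ε`. By Slater's condition there are Lagrange multipliers `μ` with
`f₀(x*) ≤ f₀(x) + ∑ μ_m f_m(x)` on `X`. At the comparison point `(x*, μ)` the gaps are then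
nonnegative and the errors sum to `O(1)`, so the potential keeps `λ^k` within a bounded distance
of `μ`; therefore `T ~ K²` inner iterations give the accuracy `1 / K` in every outer iteration.

Comparing the average with `(x*, 0)` bounds the objective, and comparing it with `(x*, μ + e_m)`
bounds the violation of the `m`-th constraint, both by `O(1 / K)`. With `K ~ 1 / ε` the cost is
`K · K² ~ ε⁻³`.
-/

namespace Prog

variable {N M : ℕ} {J : Fin M → ℕ} {R R' : Type} {P : RobustProblem N M J}

theorem Ensures.mono {p : Prog N M J R} {post post' : R → ℕ → Prop} (h : p.Ensures P post)
    (hpost : ∀ r c, post r c → post' r c) : p.Ensures P post' := by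
  induction p generalizing post post' with
  | ret r => exact hpost _ _ h
  | ask n q k ih => exact ⟨h.1, fun a ha => ih a (h.2 a ha) fun r c => hpost _ _⟩
  | check p k ih => exact ⟨h.1, ih h.2 hpost⟩

theorem Ensures.bind {p : Prog N M J R} {k : R → Prog N M J R'} {post : R' → ℕ → Prop}
    (h : p.Ensures P fun r c => (k r).Ensures P fun r' c' => post r' (c + c')) :
    (p.bind k).Ensures P post := by
  induction p generalizing post with
  | ret r => simpa [Prog.bind, Ensures] using h
  | ask n q k' ih =>
    refine ⟨h.1, fun a ha => ih a ((h.2 a ha).mono fun r c hr => hr.mono fun r' c' => ?_)⟩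
    simp only [add_assoc, imp_self]
  | check p k' ih => exact ⟨h.1, ih h.2⟩

end Prog

section Subgradients

variable {E : Type*} [NormedAddCommGroup E] [InnerProductSpace ℝ E]

theorem inner_le_mul_norm_of_norm_le {a b : E} {c : ℝ} (ha : ‖a‖ ≤ c) :
    inner ℝ a b ≤ c * ‖b‖ :=
  (real_inner_le_norm a b).trans (mul_le_mul_of_nonneg_right ha (norm_nonneg b))

theorem neg_mul_norm_le_inner_of_norm_le {a b : E} {c : ℝ} (ha : ‖a‖ ≤ c) :
    -(c * ‖b‖) ≤ inner ℝ a b := by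
  rw [neg_le, ← inner_neg_left]
  exact inner_le_mul_norm_of_norm_le (by rwa [norm_neg])

theorem inner_sub_sub_eq_half_sq_norm_sub (a b c : E) :
    inner ℝ (a - b) (c - a) = (‖c - b‖ ^ 2 - ‖c - a‖ ^ 2 - ‖a - b‖ ^ 2) / 2 := by
  have h : c - b = (c - a) + (a - b) := by abel
  rw [h, norm_add_sq_real, real_inner_comm]
  ring

/-- `ξ` is a subgradient at `x` of the restriction to `S` of the real-valued function `φ`. -/
def IsSubgradOn (S : Set E) (φ : E → ℝ) (x ξ : E) : Prop :=
  ∀ y ∈ S, φ x + inner ℝ ξ (y - x) ≤ φ y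

namespace IsSubgradOn

variable {S : Set E} {φ ψ : E → ℝ} {x y ξ η : E} {L : ℝ}

theorem add (hξ : IsSubgradOn S φ x ξ) (hη : IsSubgradOn S ψ x η) :
    IsSubgradOn S (fun y => φ y + ψ y) x (ξ + η) := by
  intro y hy
  rw [inner_add_left]
  linarith [hξ y hy, hη y hy]

theorem const_smul {c : ℝ} (hc : 0 ≤ c) (hξ : IsSubgradOn S φ x ξ) :
    IsSubgradOn S (fun y => c * φ y) x (c • ξ) := by
  intro y hy
  rw [real_inner_smul_left, ← mul_add]
  exact mul_le_mul_of_nonneg_left (hξ y hy) hc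

theorem sum {ι : Type*} {s : Finset ι} {φ : ι → E → ℝ} {ξ : ι → E}
    (h : ∀ i ∈ s, IsSubgradOn S (φ i) x (ξ i)) :
    IsSubgradOn S (fun y => ∑ i ∈ s, φ i y) x (∑ i ∈ s, ξ i) := by
  intro y hy
  rw [sum_inner, ← Finset.sum_add_distrib]
  exact Finset.sum_le_sum fun i hi => h i hi y hy

theorem sub_le_mul_norm (hξ : IsSubgradOn S φ x ξ) (hL : ‖ξ‖ ≤ L) (hy : y ∈ S) :
    φ x - φ y ≤ L * ‖x - y‖ := by
  have h := neg_mul_norm_le_inner_of_norm_le (b := y - x) hL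
  rw [norm_sub_rev] at h
  linarith [hξ y hy]

theorem sub_le_inner_add (hξ : IsSubgradOn S φ x ξ) (hL : ‖ξ‖ ≤ L) {u : E}
    (hy : φ y - φ x ≤ L * ‖y - x‖) (hu : u ∈ S) :
    φ y - φ u ≤ inner ℝ ξ (y - u) + 2 * L * ‖y - x‖ := by
  have h := neg_mul_norm_le_inner_of_norm_le (b := y - x) hL
  rw [← sub_sub_sub_cancel_right y u x, inner_sub_right]
  linarith [hξ u hu]

end IsSubgradOn

theorem convexOn_of_forall_exists_isSubgradOn {S : Set E} {φ : E → ℝ} (hS : Convex ℝ S)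
    (h : ∀ x ∈ S, ∃ ξ, IsSubgradOn S φ x ξ) : ConvexOn ℝ S φ := by
  refine ⟨hS, fun x hx y hy a b ha hb hab => ?_⟩
  obtain ⟨ξ, hξ⟩ := h _ (hS hx hy ha hb hab)
  set p := a • x + b • y
  have hbalance : a * inner ℝ ξ (x - p) + b * inner ℝ ξ (y - p) = 0 := by
    have hp : a • (x - p) + b • (y - p) = 0 := by
      rw [smul_sub, smul_sub, sub_add_sub_comm, ← add_smul, hab, one_smul, sub_self]
    rw [← real_inner_smul_right, ← real_inner_smul_right, ← inner_add_right, hp,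
      inner_zero_right]
  have hx' := mul_le_mul_of_nonneg_left (hξ x hx) ha
  have hy' := mul_le_mul_of_nonneg_left (hξ y hy) hb
  calc φ p = (a + b) * φ p := by rw [hab, one_mul]
    _ ≤ a * φ x + b * φ y := by linarith

end Subgradients

section Averages

open scoped Pointwise

variable {E : Type*} [AddCommGroup E] [Module ℝ E] {S : Set E} {φ : E → ℝ} {n : ℕ} {s x : E}

/-- The perspective `n φ (s / n)` of `φ`. At the sum `s` of the first `n` iterates of an algorithm
it is `n` times the value of `φ` at their average; that `s` is a sum of `n` points of a convex set
`S` is encoded by `s ∈ n • S`. For `n = 0` it is `0`. -/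
noncomputable def perspective (φ : E → ℝ) (n : ℕ) (s : E) : ℝ :=
  n * φ ((n : ℝ)⁻¹ • s)

theorem perspective_zero (φ : E → ℝ) (s : E) : perspective φ 0 s = 0 := by
  simp [perspective]

theorem inv_natCast_smul_mem (hn : 0 < n) (hs : s ∈ (n : ℝ) • S) : (n : ℝ)⁻¹ • s ∈ S :=
  (Set.mem_smul_set_iff_inv_smul_mem₀ (by positivity) S s).1 hs

theorem zero_mem_natCast_zero_smul (hS : S.Nonempty) : (0 : E) ∈ ((0 : ℕ) : ℝ) • S := by
  rw [Nat.cast_zero, Set.zero_smul_set hS]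
  exact Set.mem_zero.2 rfl

theorem add_mem_natCast_succ_smul (hS : Convex ℝ S) (hs : s ∈ (n : ℝ) • S) (hx : x ∈ S) :
    s + x ∈ ((n + 1 : ℕ) : ℝ) • S := by
  rw [Nat.cast_succ, hS.add_smul n.cast_nonneg zero_le_one, one_smul]
  exact Set.add_mem_add hs hx

theorem perspective_succ_le (hφ : ConvexOn ℝ S φ) (hs : s ∈ (n : ℝ) • S) (hx : x ∈ S) :
    perspective φ (n + 1) (s + x) ≤ perspective φ n s + φ x := by
  rcases n.eq_zero_or_pos with rfl | hn
  · rw [Nat.cast_zero] at hs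
    have hs0 : s = 0 := Set.zero_smul_set_subset S hs
    simp [perspective, hs0]
  · have hjensen := hφ.2 (inv_natCast_smul_mem hn hs) hx
      (show 0 ≤ (n : ℝ) / (n + 1) by positivity) (show 0 ≤ 1 / ((n : ℝ) + 1) by positivity)
      (by field_simp)
    have haverage : ((n + 1 : ℕ) : ℝ)⁻¹ • (s + x) =
        ((n : ℝ) / (n + 1)) • (n : ℝ)⁻¹ • s + (1 / ((n : ℝ) + 1)) • x := by
      rw [smul_smul, smul_add]
      congr 2 <;> push_cast <;> field_simp
    calc perspective φ (n + 1) (s + x)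
        = (n + 1) * φ (((n + 1 : ℕ) : ℝ)⁻¹ • (s + x)) := by simp [perspective]
      _ ≤ (n + 1) * (n / (n + 1) * φ ((n : ℝ)⁻¹ • s) + 1 / (n + 1) * φ x) := by
          rw [haverage]
          exact mul_le_mul_of_nonneg_left hjensen (by positivity)
      _ = perspective φ n s + φ x := by rw [perspective]; field_simp

end Averages

section Alternative

variable {E ι : Type*} [AddCommGroup E] [Module ℝ E] {X : Set E}

theorem nonneg_of_forall_pos_add_mul {a b : ℝ} (h : ∀ s, 0 < s → 0 < a + s * b) :
    0 ≤ a ∧ 0 ≤ b := by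
  constructor <;> by_contra! hneg
  · have hb : 0 < b := by linarith [h 1 one_pos]
    have hzero := h (-a / b) (div_pos (neg_pos.2 hneg) hb)
    rw [div_mul_cancel₀ _ hb.ne'] at hzero
    linarith
  · have ha : 0 < a := by linarith [h 1 one_pos]
    have hzero := h (-a / b) (div_pos_of_neg_of_neg (neg_lt_zero.2 ha) hneg)
    rw [div_mul_cancel₀ _ hneg.ne] at hzero
    linarith

theorem isOpen_convex_setOf_forall_lt [Finite ι] {f : ι → E → ℝ} (hX : Convex ℝ X)
    (hf : ∀ i, ConvexOn ℝ X (f i)) :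
    IsOpen {q : ι → ℝ | ∃ x ∈ X, ∀ i, f i x < q i} ∧
      Convex ℝ {q : ι → ℝ | ∃ x ∈ X, ∀ i, f i x < q i} := by
  constructor
  · have hunion : {q : ι → ℝ | ∃ x ∈ X, ∀ i, f i x < q i} =
        ⋃ x ∈ X, Set.univ.pi fun i => Set.Ioi (f i x) := by
      ext q; simp
    rw [hunion]
    exact isOpen_biUnion fun x _ => isOpen_set_pi Set.finite_univ fun i _ => isOpen_Ioi
  · rintro p ⟨x, hx, hxp⟩ q ⟨y, hy, hyq⟩ a b ha hb hab
    exact ⟨a • x + b • y, hX hx hy ha hb hab, fun i =>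
      ((hf i).convex_strict_epigraph (x := (x, p i)) ⟨hx, hxp i⟩ (y := (y, q i)) ⟨hy, hyq i⟩
        ha hb hab).2⟩

variable [Fintype ι]

/-- Fan–Glicksberg–Hoffman theorem of the alternative. -/
theorem exists_nonneg_weights_of_forall_exists_nonneg {f : ι → E → ℝ} (hne : X.Nonempty)
    (hf : ∀ i, ConvexOn ℝ X (f i)) (h : ∀ x ∈ X, ∃ i, 0 ≤ f i x) :
    ∃ w : ι → ℝ, w ≠ 0 ∧ (∀ i, 0 ≤ w i) ∧ ∀ x ∈ X, 0 ≤ ∑ i, w i * f i x := by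
  classical
  obtain ⟨x, hx⟩ := hne
  obtain ⟨i, -⟩ := h x hx
  obtain ⟨hopen, hconvex⟩ := isOpen_convex_setOf_forall_lt (hf i).1 hf
  have hzero : (0 : ι → ℝ) ∉ {q : ι → ℝ | ∃ x ∈ X, ∀ i, f i x < q i} := by
    rintro ⟨x, hx, hlt⟩
    obtain ⟨i, hi⟩ := h x hx
    exact (hlt i).not_ge hi
  obtain ⟨l, hl⟩ := geometric_hahn_banach_open_point hconvex hopen hzero
  let w : ι → ℝ := fun i => -l fun j => if i = j then 1 else 0
  have hrepr : ∀ q, ∑ i, w i * q i = -l q := fun q => by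
    have hsum := LinearMap.pi_apply_eq_sum_univ l.toLinearMap q
    simp only [ContinuousLinearMap.coe_coe, smul_eq_mul] at hsum
    rw [hsum, ← Finset.sum_neg_distrib]
    exact Finset.sum_congr rfl fun i _ => by simp only [w]; ring
  have hpos : ∀ x ∈ X, ∀ t : ι → ℝ, (∀ i, 0 < t i) → 0 < -l ((f · x) + t) := fun x hx t ht => by
    have hlt := hl ((f · x) + t) ⟨x, hx, fun i => lt_add_of_pos_right _ (ht i)⟩
    rwa [map_zero, ← neg_pos] at hlt
  refine ⟨w, fun hw => ?_, fun i => ?_, fun y hy => ?_⟩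
  · have hlt := hpos x hx 1 fun _ => one_pos
    simp [← hrepr, hw] at hlt
  · refine (nonneg_of_forall_pos_add_mul (a := -l ((f · x) + 1)) fun s hs => ?_).2
    have hlt := hpos x hx (1 + s • fun j => if i = j then 1 else 0) fun j => by
      simp only [Pi.add_apply, Pi.one_apply, Pi.smul_apply, smul_eq_mul]
      split_ifs <;> linarith
    rw [← add_assoc, map_add, map_smul, smul_eq_mul] at hlt
    simp only [w]
    linarith
  · refine (nonneg_of_forall_pos_add_mul (b := -l 1) fun s hs => ?_).1
    have hlt := hpos y hy (s • 1) fun _ => by simpa using hs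
    rw [map_add, map_smul, smul_eq_mul] at hlt
    rw [hrepr]
    linarith

theorem exists_multipliers_of_slater {φ : E → ℝ} {f : ι → E → ℝ} {c : ℝ} (hφ : ConvexOn ℝ X φ)
    (hf : ∀ i, ConvexOn ℝ X (f i)) (hslater : ∃ x ∈ X, ∀ i, f i x < 0)
    (hc : ∀ x ∈ X, (∀ i, f i x ≤ 0) → c ≤ φ x) :
    ∃ μ : ι → ℝ, (∀ i, 0 ≤ μ i) ∧ ∀ x ∈ X, c ≤ φ x + ∑ i, μ i * f i x := by
  obtain ⟨xs, hxs, hneg⟩ := hslater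
  let F : Option ι → E → ℝ := fun o => o.elim (fun x => φ x + -c) f
  obtain ⟨w, hw0, hw, hcomb⟩ := exists_nonneg_weights_of_forall_exists_nonneg (f := F) ⟨xs, hxs⟩
    (Option.rec (hφ.add_const (-c)) hf) fun x hx => by
      by_contra! hlt
      linarith [hc x hx fun i => (hlt (some i)).le, show φ x + -c < 0 from hlt none]
  simp only [Fintype.sum_option, F, Option.elim] at hcomb
  have hpos : 0 < w none := by
    refine (hw none).lt_of_ne fun hnone => hw0 (funext (Option.rec hnone.symm fun i => ?_))
    have hterm : ∀ i ∈ Finset.univ, w (some i) * f i xs ≤ 0 := fun i _ =>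
      mul_nonpos_of_nonneg_of_nonpos (hw _) (hneg i).le
    have hsum := hcomb xs hxs
    rw [← hnone, zero_mul, zero_add] at hsum
    have hi := (Finset.sum_eq_zero_iff_of_nonpos hterm).1
      (le_antisymm (Finset.sum_nonpos hterm) hsum) i (Finset.mem_univ i)
    exact (mul_eq_zero.1 hi).resolve_right (hneg i).ne
  refine ⟨fun i => w (some i) / w none, fun i => div_nonneg (hw _) hpos.le, fun x hx => ?_⟩
  have hscaled := div_nonneg (hcomb x hx) hpos.le
  rw [add_div, mul_div_cancel_left₀ _ hpos.ne', Finset.sum_div] at hscaled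
  simp only [div_mul_eq_mul_div]
  linarith

end Alternative

theorem mul_sub_sq_le (a r : ℝ) {h : ℝ} (hh : 0 < h) :
    a * r - 1 / (2 * h) * r ^ 2 ≤ a ^ 2 * h / 2 := by
  have hsquare : a ^ 2 * h / 2 - (a * r - 1 / (2 * h) * r ^ 2) = (a * h - r) ^ 2 / (2 * h) := by
    field_simp
    ring
  have hnonneg : 0 ≤ (a * h - r) ^ 2 / (2 * h) := by positivity
  linarith

/-- The part of the potential of extrapolated subgradient descent with weight `lam` and step size
`δ` that measures the distance of the iterate `z` to the comparison point `v`. The inner product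
with the last subgradient `ζ` makes the extrapolation telescope. -/
noncomputable def extrapolationPotential {n : ℕ} (δ lam : ℝ) (v z ζ : Vec n) : ℝ :=
  1 / (2 * δ) * ‖v - z‖ ^ 2 + lam * inner ℝ ζ (z - v)

theorem exists_isProj {n : ℕ} {S : Set (Vec n)} (hne : S.Nonempty) (hS : IsCompact S)
    (y : Vec n) : ∃ p, IsProj S y p := by
  obtain ⟨p, hp, hmin⟩ := hS.exists_isMinOn hne (f := fun w => ‖y - w‖) (by fun_prop)
  exact ⟨p, hp, fun w hw => hmin hw⟩

namespace IsProj

variable {n : ℕ} {S : Set (Vec n)} {φ φ' : Vec n → ℝ}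

theorem inner_le_zero (hS : Convex ℝ S) {y p w : Vec n} (h : IsProj S y p) (hw : w ∈ S) :
    inner ℝ (y - p) (w - p) ≤ 0 := by
  refine (norm_eq_iInf_iff_real_inner_le_zero hS h.1).1 ?_ w hw
  have : Nonempty S := ⟨⟨p, h.1⟩⟩
  refine le_antisymm (le_ciInf fun w => h.2 w w.2) ?_
  exact ciInf_le (f := fun w : S => ‖y - w‖) ⟨0, by rintro _ ⟨w, rfl⟩; exact norm_nonneg _⟩ ⟨p, h.1⟩

theorem three_point (hS : Convex ℝ S) {z a p v : Vec n} (h : IsProj S (z - a) p) (hv : v ∈ S) :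
    inner ℝ a (p - v) ≤ (‖v - z‖ ^ 2 - ‖v - p‖ ^ 2 - ‖p - z‖ ^ 2) / 2 := by
  have hproj := h.inner_le_zero hS hv
  rw [← inner_sub_sub_eq_half_sq_norm_sub p z v]
  simp only [inner_sub_left, inner_sub_right] at hproj ⊢
  linarith

theorem three_point_prox (hS : Convex ℝ S) {α γ : ℝ} (hα : 0 < α) (hγ : 0 < γ)
    {xk x ξ p u : Vec n}
    (h : IsProj S ((α * γ / (α + γ)) • ((1 / α) • xk + (1 / γ) • x - ξ)) p) (hu : u ∈ S) :
    inner ℝ ξ (p - u) ≤ 1 / (2 * α) * (‖u - xk‖ ^ 2 - ‖u - p‖ ^ 2 - ‖p - xk‖ ^ 2) +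
      1 / (2 * γ) * (‖u - x‖ ^ 2 - ‖u - p‖ ^ 2 - ‖p - x‖ ^ 2) := by
  have hαγ : α + γ ≠ 0 := by positivity
  have hresidual : (α * γ / (α + γ)) • ((1 / α) • xk + (1 / γ) • x - ξ) - p =
      (α * γ / (α + γ)) • -((1 / α) • (p - xk) + (1 / γ) • (p - x) + ξ) := by
    match_scalars <;> field_simp
    ring
  have hproj := h.inner_le_zero hS hu
  rw [hresidual, real_inner_smul_left] at hproj
  have hscaled := nonpos_of_mul_nonpos_right hproj (by positivity)
  simp only [inner_neg_left, inner_add_left, real_inner_smul_left,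
    inner_sub_sub_eq_half_sq_norm_sub] at hscaled
  rw [← neg_sub u p, inner_neg_right]
  calc -inner ℝ ξ (u - p)
      ≤ 1 / α * ((‖u - xk‖ ^ 2 - ‖u - p‖ ^ 2 - ‖p - xk‖ ^ 2) / 2) +
        1 / γ * ((‖u - x‖ ^ 2 - ‖u - p‖ ^ 2 - ‖p - x‖ ^ 2) / 2) := by linarith
    _ = _ := by field_simp

theorem subgradient_step (hS : Convex ℝ S) {s L : ℝ} (hs : 0 < s) {z ζ p v : Vec n}
    (h : IsProj S (z - s • ζ) p) (hζ : IsSubgradOn S φ z ζ) (hL : ‖ζ‖ ≤ L) (hv : v ∈ S) :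
    φ z - φ v + 1 / (2 * s) * ‖v - p‖ ^ 2 ≤ 1 / (2 * s) * ‖v - z‖ ^ 2 + L ^ 2 * s / 2 := by
  have hproj := h.three_point hS hv
  rw [real_inner_smul_left, ← le_div_iff₀' hs] at hproj
  have hsplit : inner ℝ ζ (z - v) = inner ℝ ζ (p - v) - inner ℝ ζ (p - z) := by
    rw [← inner_sub_right, sub_sub_sub_cancel_left]
  have hdrift := neg_mul_norm_le_inner_of_norm_le (b := p - z) hL
  have hyoung := mul_sub_sq_le L ‖p - z‖ hs
  have hsub := hζ v hv
  rw [← neg_sub z v, inner_neg_right] at hsub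
  calc _ ≤ (‖v - z‖ ^ 2 - ‖v - p‖ ^ 2 - ‖p - z‖ ^ 2) / 2 / s + L * ‖p - z‖ +
        1 / (2 * s) * ‖v - p‖ ^ 2 := by linarith
    _ = 1 / (2 * s) * ‖v - z‖ ^ 2 + (L * ‖p - z‖ - 1 / (2 * s) * ‖p - z‖ ^ 2) := by
        field_simp
        ring
    _ ≤ _ := by linarith

theorem prox_subgradient_step (hS : Convex ℝ S) {α γ L : ℝ} (hα : 0 < α) (hγ : 0 < γ)
    {xk x ξ p u : Vec n}
    (h : IsProj S ((α * γ / (α + γ)) • ((1 / α) • xk + (1 / γ) • x - ξ)) p)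
    (hξ : IsSubgradOn S φ x ξ) (hL : ‖ξ‖ ≤ L) (hp : φ p - φ x ≤ L * ‖p - x‖) (hu : u ∈ S) :
    φ p + 1 / (2 * α) * ‖p - xk‖ ^ 2 - (φ u + 1 / (2 * α) * ‖u - xk‖ ^ 2) +
        1 / (2 * α) * ‖u - p‖ ^ 2 + 1 / (2 * γ) * ‖u - p‖ ^ 2 ≤
      1 / (2 * γ) * ‖u - x‖ ^ 2 - 1 / (2 * γ) * ‖p - x‖ ^ 2 + 2 * L * ‖p - x‖ := by
  linarith [h.three_point_prox hS hα hγ hu, hξ.sub_le_inner_add hL hp hu]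

/-- The functions `φ` and `φ'` are the old and the new objective, which differ by at most `e`. -/
theorem extrapolated_step (hS : Convex ℝ S) {δ lam e L : ℝ} (hδ : 0 < δ) (hlam : 0 ≤ lam)
    {z ζ ζp p v : Vec n} (h : IsProj S (z - (δ * lam) • ((2 : ℝ) • ζ - ζp)) p)
    (hζ : IsSubgradOn S φ z ζ) (hζL : ‖ζ‖ ≤ L) (hζpL : ‖ζp‖ ≤ L) (hv : v ∈ S)
    (hφv : φ v ≤ φ' v + e) (hφz : φ' z ≤ φ z + e) (hp : φ' p - φ' z ≤ L * ‖p - z‖) :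
    lam * (φ' p - φ' v) + extrapolationPotential δ lam v p ζ ≤
      extrapolationPotential δ lam v z ζp + 2 * lam * e + 9 / 2 * (lam * L) ^ 2 * δ := by
  have hproj := h.three_point hS hv
  rw [real_inner_smul_left, mul_assoc, ← le_div_iff₀' hδ] at hproj
  have hsplit : inner ℝ ((2 : ℝ) • ζ - ζp) (p - v) = inner ℝ ζ (p - v) + inner ℝ ζ (p - z) -
      inner ℝ ζp (p - z) - inner ℝ ζp (z - v) - inner ℝ ζ (v - z) := by
    simp only [inner_sub_left, inner_sub_right, real_inner_smul_left]
    ring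
  have hdrift := neg_mul_norm_le_inner_of_norm_le (b := p - z) hζL
  have hdrift' := inner_le_mul_norm_of_norm_le (b := p - z) hζpL
  have hgap : φ' p - φ' v ≤ inner ℝ ((2 : ℝ) • ζ - ζp) (p - v) - inner ℝ ζ (p - v) +
      inner ℝ ζp (z - v) + 2 * e + 3 * L * ‖p - z‖ := by
    linarith [hζ v hv]
  have hyoung := mul_sub_sq_le (3 * (lam * L)) ‖p - z‖ hδ
  have hscale : (‖v - z‖ ^ 2 - ‖v - p‖ ^ 2 - ‖p - z‖ ^ 2) / 2 / δ = 1 / (2 * δ) * ‖v - z‖ ^ 2 -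
      1 / (2 * δ) * ‖v - p‖ ^ 2 - 1 / (2 * δ) * ‖p - z‖ ^ 2 := by
    field_simp
  rw [extrapolationPotential, extrapolationPotential]
  linarith [mul_le_mul_of_nonneg_left hgap hlam]

end IsProj

theorem norm_sub_le_diam {E : Type*} [SeminormedAddCommGroup E] {S : Set E} (hS : IsCompact S)
    {x y : E} (hx : x ∈ S) (hy : y ∈ S) : ‖x - y‖ ≤ Metric.diam S := by
  rw [← dist_eq_norm]
  exact Metric.dist_le_diam_of_mem hS.isBounded hx hy

theorem isSubgradOn_toReal {n : ℕ} {f : Vec n → EReal} {S : Set (Vec n)} {x ξ : Vec n}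
    (hf : ∀ y ∈ S, f y ≠ ⊥ ∧ f y ≠ ⊤) (hx : x ∈ S) (h : ξ ∈ subdiff f x) :
    IsSubgradOn S (fun y => (f y).toReal) x ξ := by
  intro y hy
  have hsub := h y
  rw [← EReal.coe_toReal (hf x hx).2 (hf x hx).1, ← EReal.coe_toReal (hf y hy).2 (hf y hy).1]
    at hsub
  exact_mod_cast hsub

namespace RobustProblem

variable {N M : ℕ} {J : Fin M → ℕ}

/-- The objective as a real-valued function; meaningful only on `X`. -/
noncomputable def obj (P : RobustProblem N M J) (x : Vec N) : ℝ := (P.f0 x).toReal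

/-- The constraint functions `g m` as real-valued functions; meaningful only on `X × Z m`. -/
noncomputable def con (P : RobustProblem N M J) (m : Fin M) (x : Vec N) (z : Vec (J m)) : ℝ :=
  (P.g m x z).toReal

/-- The worst-case constraint functions as real-valued functions; meaningful only on `X`. -/
noncomputable def worstCon (P : RobustProblem N M J) (m : Fin M) (x : Vec N) : ℝ :=
  (P.worst m x).toReal

variable {P : RobustProblem N M J} {D0 : ℝ} {D B : Fin M → ℝ} {m : Fin M} {x y ξ : Vec N}
  {z v ζ : Vec (J m)}

theorem coe_obj (hP : P.Standing) (hx : x ∈ P.X) : (P.obj x : EReal) = P.f0 x :=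
  EReal.coe_toReal (hP.f0_finite x hx) (hP.f0_ne_bot x)

theorem coe_con (hP : P.Standing) (hx : x ∈ P.X) (hz : z ∈ P.Z m) :
    (P.con m x z : EReal) = P.g m x z :=
  EReal.coe_toReal (hP.g_finite m x hx z hz).2 (hP.g_finite m x hx z hz).1

theorem isSubgradOn_obj (hP : P.Standing) (hx : x ∈ P.X) (h : ξ ∈ subdiff P.f0 x) :
    IsSubgradOn P.X P.obj x ξ :=
  isSubgradOn_toReal (fun y hy => ⟨hP.f0_ne_bot y, hP.f0_finite y hy⟩) hx h

theorem isSubgradOn_con (hP : P.Standing) (hx : x ∈ P.X) (hz : z ∈ P.Z m)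
    (h : ξ ∈ subdiff (fun x' => P.g m x' z) x) : IsSubgradOn P.X (fun x' => P.con m x' z) x ξ :=
  isSubgradOn_toReal (fun y hy => hP.g_finite m y hy z hz) hx h

theorem isSubgradOn_neg_con (hP : P.Standing) (hx : x ∈ P.X) (hz : z ∈ P.Z m)
    (h : ζ ∈ subdiff (fun z' => -P.g m x z') z) :
    IsSubgradOn (P.Z m) (fun z' => -P.con m x z') z ζ := by
  simp only [con, ← EReal.toReal_neg_eq]
  refine isSubgradOn_toReal (fun v hv => ?_) hz h
  simpa [and_comm] using hP.g_finite m x hx v hv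

theorem con_sub_le_left (hP : P.Standing) (hB : P.BoundedSubdiff D0 D B) (hx : x ∈ P.X)
    (hy : y ∈ P.X) (hz : z ∈ P.Z m) : P.con m x z - P.con m y z ≤ D m * ‖x - y‖ := by
  obtain ⟨ξ, hξ⟩ := hB.gx_nonempty m x hx z hz
  exact (isSubgradOn_con hP hx hz hξ).sub_le_mul_norm (hB.gx_bound m x hx z hz ξ hξ) hy

theorem con_sub_le_right (hP : P.Standing) (hB : P.BoundedSubdiff D0 D B) (hx : x ∈ P.X)
    (hz : z ∈ P.Z m) (hv : v ∈ P.Z m) : P.con m x z - P.con m x v ≤ B m * ‖z - v‖ := by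
  obtain ⟨ζ, hζ⟩ := hB.gz_nonempty m x hx v hv
  have h := (isSubgradOn_neg_con hP hx hv hζ).sub_le_mul_norm (hB.gz_bound m x hx v hv ζ hζ) hz
  rw [norm_sub_rev] at h
  linarith

theorem convexOn_obj (hP : P.Standing) (hB : P.BoundedSubdiff D0 D B) : ConvexOn ℝ P.X P.obj :=
  convexOn_of_forall_exists_isSubgradOn hP.X_convex fun x hx =>
    (hB.f0_nonempty x hx).imp fun _ => isSubgradOn_obj hP hx

theorem convexOn_con (hP : P.Standing) (hB : P.BoundedSubdiff D0 D B) (hz : z ∈ P.Z m) :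
    ConvexOn ℝ P.X (fun x => P.con m x z) :=
  convexOn_of_forall_exists_isSubgradOn hP.X_convex fun x hx =>
    (hB.gx_nonempty m x hx z hz).imp fun _ => isSubgradOn_con hP hx hz

theorem convexOn_neg_con (hP : P.Standing) (hB : P.BoundedSubdiff D0 D B) (hx : x ∈ P.X) :
    ConvexOn ℝ (P.Z m) (fun z => -P.con m x z) :=
  convexOn_of_forall_exists_isSubgradOn (hP.Z_convex m) fun z hz =>
    (hB.gz_nonempty m x hx z hz).imp fun _ => isSubgradOn_neg_con hP hx hz

theorem exists_isMaxOn_con (hP : P.Standing) (hB : P.BoundedSubdiff D0 D B) (m : Fin M)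
    (hx : x ∈ P.X) : ∃ z ∈ P.Z m, IsMaxOn (P.con m x) (P.Z m) z := by
  have hlipschitz : LipschitzOnWith (B m).toNNReal (P.con m x) (P.Z m) :=
    LipschitzOnWith.of_le_add_mul _ fun z hz v hv => by
      rw [Real.coe_toNNReal _ (hB.B_pos m).le, dist_eq_norm]
      linarith [con_sub_le_right hP hB hx hz hv]
  exact (hP.Z_compact m).exists_isMaxOn (hP.Z_nonempty m) hlipschitz.continuousOn

theorem exists_worst_eq (hP : P.Standing) (hB : P.BoundedSubdiff D0 D B) (m : Fin M)
    (hx : x ∈ P.X) : ∃ z ∈ P.Z m, P.worst m x = P.g m x z := by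
  obtain ⟨z, hz, hmax⟩ := exists_isMaxOn_con hP hB m hx
  refine ⟨z, hz, le_antisymm (iSup₂_le fun v hv => ?_)
    (le_iSup₂ (f := fun v _ => P.g m x v) z hz)⟩
  rw [← coe_con hP hx hz, ← coe_con hP hx hv]
  exact_mod_cast hmax hv

theorem exists_worstCon_eq (hP : P.Standing) (hB : P.BoundedSubdiff D0 D B) (m : Fin M)
    (hx : x ∈ P.X) : ∃ z ∈ P.Z m, P.worstCon m x = P.con m x z := by
  obtain ⟨z, hz, h⟩ := exists_worst_eq hP hB m hx
  exact ⟨z, hz, by rw [worstCon, h, con]⟩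

theorem coe_worstCon (hP : P.Standing) (hB : P.BoundedSubdiff D0 D B) (m : Fin M)
    (hx : x ∈ P.X) : (P.worstCon m x : EReal) = P.worst m x := by
  obtain ⟨z, hz, h⟩ := exists_worst_eq hP hB m hx
  rw [worstCon, h]
  exact coe_con hP hx hz

theorem con_le_worstCon (hP : P.Standing) (hB : P.BoundedSubdiff D0 D B) (hx : x ∈ P.X)
    (hz : z ∈ P.Z m) : P.con m x z ≤ P.worstCon m x := by
  have h : P.g m x z ≤ P.worst m x := le_iSup₂ (f := fun v _ => P.g m x v) z hz
  rw [← coe_worstCon hP hB m hx, ← coe_con hP hx hz] at h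
  exact_mod_cast h

theorem worstCon_sub_le (hP : P.Standing) (hB : P.BoundedSubdiff D0 D B) (m : Fin M)
    (hx : x ∈ P.X) (hy : y ∈ P.X) : P.worstCon m x - P.worstCon m y ≤ D m * ‖x - y‖ := by
  obtain ⟨z, hz, h⟩ := exists_worstCon_eq hP hB m hx
  linarith [con_sub_le_left hP hB hx hy hz, con_le_worstCon hP hB hy hz]

theorem convexOn_worstCon (hP : P.Standing) (hB : P.BoundedSubdiff D0 D B) (m : Fin M) :
    ConvexOn ℝ P.X (P.worstCon m) :=
  convexOn_of_forall_exists_isSubgradOn hP.X_convex fun x hx => by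
    obtain ⟨z, hz, h⟩ := exists_worstCon_eq hP hB m hx
    refine (hB.gx_nonempty m x hx z hz).imp fun ξ hξ y hy => ?_
    rw [h]
    exact (isSubgradOn_con hP hx hz hξ y hy).trans (con_le_worstCon hP hB hy hz)

theorem isApproxMaximiser_iff (hP : P.Standing) (hB : P.BoundedSubdiff D0 D B) (hx : x ∈ P.X)
    (hz : z ∈ P.Z m) (θ : ℝ) :
    P.IsApproxMaximiser θ x m z ↔ P.worstCon m x ≤ P.con m x z + θ := by
  rw [IsApproxMaximiser, ← coe_worstCon hP hB m hx, ← coe_con hP hx hz]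
  simp only [hz, true_and]
  exact_mod_cast Iff.rfl

theorem isFeasible_iff (hP : P.Standing) (hB : P.BoundedSubdiff D0 D B) (hx : x ∈ P.X) :
    P.IsFeasible x ↔ ∀ m, P.worstCon m x ≤ 0 := by
  simp only [IsFeasible, hx, true_and, ← coe_worstCon hP hB _ hx, EReal.coe_nonpos]

theorem exists_forall_abs_con_le (hP : P.Standing) (hB : P.BoundedSubdiff D0 D B) :
    ∃ A : ℝ, 0 ≤ A ∧ ∀ m, ∀ x ∈ P.X, ∀ z ∈ P.Z m, |P.con m x z| ≤ A := by
  obtain ⟨x₀, hx₀⟩ := hP.X_nonempty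
  choose z₀ hz₀ using hP.Z_nonempty
  let a : Fin M → ℝ := fun m =>
    |P.con m x₀ (z₀ m)| + D m * Metric.diam P.X + B m * Metric.diam (P.Z m)
  have hD : ∀ m, 0 ≤ D m := fun m => (hB.D_pos m).le
  have hB' : ∀ m, 0 ≤ B m := fun m => (hB.B_pos m).le
  have ha : ∀ m, 0 ≤ a m := fun m =>
    add_nonneg (add_nonneg (abs_nonneg _) (mul_nonneg (hD m) Metric.diam_nonneg))
      (mul_nonneg (hB' m) Metric.diam_nonneg)
  refine ⟨∑ m, a m, Finset.sum_nonneg fun m _ => ha m, fun m x hx z hz => ?_⟩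
  refine le_trans ?_ (Finset.single_le_sum (fun m _ => ha m) (Finset.mem_univ m))
  have hx_diam : ∀ x ∈ P.X, ∀ y ∈ P.X, D m * ‖x - y‖ ≤ D m * Metric.diam P.X :=
    fun x hx y hy => mul_le_mul_of_nonneg_left (norm_sub_le_diam hP.X_compact hx hy) (hD m)
  have hz_diam : ∀ z ∈ P.Z m, ∀ v ∈ P.Z m, B m * ‖z - v‖ ≤ B m * Metric.diam (P.Z m) :=
    fun z hz v hv =>
      mul_le_mul_of_nonneg_left (norm_sub_le_diam (hP.Z_compact m) hz hv) (hB' m)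
  rw [abs_le]
  constructor
  · linarith [con_sub_le_left hP hB hx₀ hx hz, con_sub_le_right hP hB hx₀ (hz₀ m) hz,
      hx_diam x₀ hx₀ x hx, hz_diam (z₀ m) (hz₀ m) z hz, neg_abs_le (P.con m x₀ (z₀ m))]
  · linarith [con_sub_le_left hP hB hx hx₀ hz, con_sub_le_right hP hB hx₀ hz (hz₀ m),
      hx_diam x hx x₀ hx₀, hz_diam z hz (z₀ m) (hz₀ m), le_abs_self (P.con m x₀ (z₀ m))]

end RobustProblem

theorem convexOn_finset_sum {E ι : Type*} [AddCommGroup E] [Module ℝ E] {S : Set E}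
    (hS : Convex ℝ S) (s : Finset ι) {f : ι → E → ℝ} (hf : ∀ i ∈ s, ConvexOn ℝ S (f i)) :
    ConvexOn ℝ S (fun x => ∑ i ∈ s, f i x) := by
  refine ⟨hS, fun x hx y hy a b ha hb hab => ?_⟩
  rw [Finset.smul_sum, Finset.smul_sum, ← Finset.sum_add_distrib]
  exact Finset.sum_le_sum fun i hi => (hf i hi).2 hx hy ha hb hab

theorem convexOn_mul_sq_norm_sub {E : Type*} [SeminormedAddCommGroup E] [NormedSpace ℝ E]
    {S : Set E} (hS : Convex ℝ S) {c : ℝ} (hc : 0 ≤ c) (y : E) :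
    ConvexOn ℝ S (fun x => c * ‖x - y‖ ^ 2) := by
  simp only [← dist_eq_norm]
  exact ((convexOn_dist y hS).pow (fun _ _ => dist_nonneg) 2).smul hc

namespace RobustProblem

variable {N M : ℕ} {J : Fin M → ℕ}

/-- The product `X × Z` on which the inner saddle-point problem lives. -/
def domain (P : RobustProblem N M J) : Set (Vec N × ((m : Fin M) → Vec (J m))) :=
  P.X ×ˢ Set.univ.pi P.Z

/-- The inner objective without its proximal term. -/
noncomputable def innerLagrangian (P : RobustProblem N M J) (lam : Fin M → ℝ) (x : Vec N)
    (z : (m : Fin M) → Vec (J m)) : ℝ :=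
  P.obj x + ∑ m, lam m * P.con m x (z m)

/-- The amount by which the iterate `p` violates, at the comparison point `(u, v)`, the inequality
that defines a strong saddle point of the inner problem. -/
noncomputable def innerGap (P : RobustProblem N M J) (α : ℝ) (lam : Fin M → ℝ) (xk u : Vec N)
    (v : (m : Fin M) → Vec (J m)) (p : Vec N × ((m : Fin M) → Vec (J m))) : ℝ :=
  P.innerObj α lam xk p.1 v - P.innerObj α lam xk u p.2 + 1 / (2 * α) * ‖u - p.1‖ ^ 2

variable {P : RobustProblem N M J} {D0 : ℝ} {D B : Fin M → ℝ} {α γ δ : ℝ} {lam : Fin M → ℝ}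
  {xk x x' u ξ0 : Vec N} {ξ : Fin M → Vec N} {z z' v ζ ζp : (m : Fin M) → Vec (J m)}

theorem mem_domain {p : Vec N × ((m : Fin M) → Vec (J m))} :
    p ∈ P.domain ↔ p.1 ∈ P.X ∧ ∀ m, p.2 m ∈ P.Z m := by
  simp [domain]

theorem domain_nonempty (hP : P.Standing) : P.domain.Nonempty :=
  hP.X_nonempty.prod (Set.univ_pi_nonempty_iff.2 hP.Z_nonempty)

theorem convex_domain (hP : P.Standing) : Convex ℝ P.domain :=
  hP.X_convex.prod (convex_pi fun m _ => hP.Z_convex m)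

theorem innerObj_eq_innerLagrangian_add :
    P.innerObj α lam xk x z = P.innerLagrangian lam x z + 1 / (2 * α) * ‖x - xk‖ ^ 2 :=
  rfl

theorem convexOn_innerObj_left (hP : P.Standing) (hB : P.BoundedSubdiff D0 D B) (hα : 0 ≤ α)
    (hlam : ∀ m, 0 ≤ lam m) (xk : Vec N) (hv : ∀ m, v m ∈ P.Z m) :
    ConvexOn ℝ P.X (fun x => P.innerObj α lam xk x v) :=
  ((convexOn_obj hP hB).add (convexOn_finset_sum hP.X_convex _ fun m _ =>
    (convexOn_con hP hB (hv m)).smul (hlam m))).add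
    (convexOn_mul_sq_norm_sub hP.X_convex (by positivity) xk)

theorem convexOn_neg_innerObj_right (hP : P.Standing) (hB : P.BoundedSubdiff D0 D B)
    (hlam : ∀ m, 0 ≤ lam m) (hu : u ∈ P.X) :
    ConvexOn ℝ (Set.univ.pi P.Z) (fun z => -P.innerObj α lam xk u z) := by
  have hZ : Convex ℝ (Set.univ.pi P.Z) := convex_pi fun m _ => hP.Z_convex m
  have hcon : ∀ m, ConvexOn ℝ (Set.univ.pi P.Z) (fun z => -P.con m u (z m)) := fun m =>
    ((convexOn_neg_con hP hB hu).comp_linearMap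
      (LinearMap.proj (φ := fun m => Vec (J m)) m)).subset (fun _ hz => Set.mem_univ_pi.1 hz m) hZ
  refine ((convexOn_finset_sum hZ Finset.univ fun m _ => (hcon m).smul (hlam m)).add_const
    (-(P.obj u + 1 / (2 * α) * ‖u - xk‖ ^ 2))).congr fun z _ => ?_
  simp only [Pi.add_apply, smul_eq_mul, mul_neg, Finset.sum_neg_distrib,
    innerObj_eq_innerLagrangian_add, innerLagrangian]
  ring

theorem convexOn_innerGap (hP : P.Standing) (hB : P.BoundedSubdiff D0 D B) (hα : 0 ≤ α)
    (hlam : ∀ m, 0 ≤ lam m) (hu : u ∈ P.X) (hv : ∀ m, v m ∈ P.Z m) :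
    ConvexOn ℝ P.domain (P.innerGap α lam xk u v) := by
  have hleft : ConvexOn ℝ P.domain (fun p => P.innerObj α lam xk p.1 v) :=
    ((convexOn_innerObj_left hP hB hα hlam xk hv).comp_linearMap (LinearMap.fst ℝ _ _)).subset
      (fun p hp => hp.1) (convex_domain hP)
  have hright : ConvexOn ℝ P.domain (fun p => -P.innerObj α lam xk u p.2) :=
    ((convexOn_neg_innerObj_right hP hB hlam hu).comp_linearMap (LinearMap.snd ℝ _ _)).subset
      (fun p hp => hp.2) (convex_domain hP)
  have hsq : ConvexOn ℝ P.domain (fun p => 1 / (2 * α) * ‖p.1 - u‖ ^ 2) :=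
    ((convexOn_mul_sq_norm_sub hP.X_convex (by positivity) u).comp_linearMap
      (LinearMap.fst ℝ _ _)).subset (fun p hp => hp.1) (convex_domain hP)
  refine ((hleft.add hright).add hsq).congr fun p _ => ?_
  simp only [Pi.add_apply, innerGap, norm_sub_rev u]
  ring

theorem isSubgradOn_innerLagrangian (hP : P.Standing) (hlam : ∀ m, 0 ≤ lam m) (hx : x ∈ P.X)
    (hz : ∀ m, z m ∈ P.Z m) (hξ0 : ξ0 ∈ subdiff P.f0 x)
    (hξ : ∀ m, ξ m ∈ subdiff (fun y => P.g m y (z m)) x) :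
    IsSubgradOn P.X (fun y => P.innerLagrangian lam y z) x (ξ0 + ∑ m, lam m • ξ m) :=
  (isSubgradOn_obj hP hx hξ0).add
    (.sum fun m _ => (isSubgradOn_con hP hx (hz m) (hξ m)).const_smul (hlam m))

theorem norm_innerLagrangian_subgrad_le (hB : P.BoundedSubdiff D0 D B) (hlam : ∀ m, 0 ≤ lam m)
    (hx : x ∈ P.X) (hz : ∀ m, z m ∈ P.Z m) (hξ0 : ξ0 ∈ subdiff P.f0 x)
    (hξ : ∀ m, ξ m ∈ subdiff (fun y => P.g m y (z m)) x) :
    ‖ξ0 + ∑ m, lam m • ξ m‖ ≤ D0 + ∑ m, lam m * D m := by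
  refine norm_add_le_of_le (hB.f0_bound x hx ξ0 hξ0) (norm_sum_le_of_le _ fun m _ => ?_)
  rw [norm_smul, Real.norm_of_nonneg (hlam m)]
  exact mul_le_mul_of_nonneg_left (hB.gx_bound m x hx (z m) (hz m) (ξ m) (hξ m)) (hlam m)

theorem innerLagrangian_sub_le (hP : P.Standing) (hB : P.BoundedSubdiff D0 D B)
    (hlam : ∀ m, 0 ≤ lam m) (hx : x ∈ P.X) (hx' : x' ∈ P.X) (hz : ∀ m, z m ∈ P.Z m) :
    P.innerLagrangian lam x z - P.innerLagrangian lam x' z ≤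
      (D0 + ∑ m, lam m * D m) * ‖x - x'‖ := by
  obtain ⟨ξ0, hξ0⟩ := hB.f0_nonempty x hx
  choose ξ hξ using fun m => hB.gx_nonempty m x hx (z m) (hz m)
  exact (isSubgradOn_innerLagrangian hP hlam hx hz hξ0 hξ).sub_le_mul_norm
    (norm_innerLagrangian_subgrad_le hB hlam hx hz hξ0 hξ) hx'

/-- The potential whose decrease bounds the gap of the iterates of the inner algorithm. -/
noncomputable def innerPotential (γ δ : ℝ) (lam : Fin M → ℝ) (u : Vec N)
    (v : (m : Fin M) → Vec (J m)) (x : Vec N) (z ζ : (m : Fin M) → Vec (J m)) : ℝ :=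
  1 / (2 * γ) * ‖u - x‖ ^ 2 + ∑ m, extrapolationPotential δ (lam m) (v m) (z m) (ζ m)

/-- The error made in one iteration of the inner algorithm with step sizes `γ` and `δ`. -/
noncomputable def innerError (D0 : ℝ) (D B lam : Fin M → ℝ) (γ δ : ℝ) : ℝ :=
  (2 * D0 + 4 * ∑ m, lam m * D m) ^ 2 * γ / 2 + ∑ m, 9 / 2 * (lam m * B m) ^ 2 * δ

theorem inner_dual_step (hP : P.Standing) (hB : P.BoundedSubdiff D0 D B) (hδ : 0 < δ)
    (hlam : ∀ m, 0 ≤ lam m) (hx : x ∈ P.X) (hx' : x' ∈ P.X) (hz : ∀ m, z m ∈ P.Z m)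
    (hv : ∀ m, v m ∈ P.Z m) (hζ : ∀ m, ζ m ∈ subdiff (fun y => -P.g m x y) (z m))
    (hζp : ∀ m, ‖ζp m‖ ≤ B m)
    (hz' : ∀ m, IsProj (P.Z m) (z m - (δ * lam m) • ((2 : ℝ) • ζ m - ζp m)) (z' m)) :
    P.innerLagrangian lam x' v - P.innerLagrangian lam x' z' +
        ∑ m, extrapolationPotential δ (lam m) (v m) (z' m) (ζ m) ≤
      ∑ m, extrapolationPotential δ (lam m) (v m) (z m) (ζp m) +
        2 * (∑ m, lam m * D m) * ‖x' - x‖ + ∑ m, 9 / 2 * (lam m * B m) ^ 2 * δ := by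
  rw [innerLagrangian, innerLagrangian, add_sub_add_left_eq_sub, ← Finset.sum_sub_distrib,
    ← Finset.sum_add_distrib, Finset.mul_sum, Finset.sum_mul, ← Finset.sum_add_distrib,
    ← Finset.sum_add_distrib]
  refine Finset.sum_le_sum fun m _ => ?_
  have hcon : ∀ z ∈ P.Z m, P.con m x' z - P.con m x z ≤ D m * ‖x' - x‖ ∧
      P.con m x z - P.con m x' z ≤ D m * ‖x' - x‖ := fun z hz =>
    ⟨con_sub_le_left hP hB hx' hx hz, norm_sub_rev x' x ▸ con_sub_le_left hP hB hx hx' hz⟩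
  have hstep := (hz' m).extrapolated_step (φ' := fun z => -P.con m x' z) (e := D m * ‖x' - x‖)
    (hP.Z_convex m) hδ (hlam m) (isSubgradOn_neg_con hP hx (hz m) (hζ m))
    (hB.gz_bound m x hx (z m) (hz m) (ζ m) (hζ m)) (hζp m) (hv m)
    (by linarith [(hcon (v m) (hv m)).1]) (by linarith [(hcon (z m) (hz m)).2])
    (by linarith [norm_sub_rev (z m) (z' m) ▸ con_sub_le_right hP hB hx' (hz m) (hz' m).1])
  linarith

theorem inner_step (hP : P.Standing) (hB : P.BoundedSubdiff D0 D B) (hα : 0 < α)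
    (hγ : 0 < γ) (hδ : 0 < δ) (hlam : ∀ m, 0 ≤ lam m) (hx : x ∈ P.X) (hu : u ∈ P.X)
    (hz : ∀ m, z m ∈ P.Z m) (hv : ∀ m, v m ∈ P.Z m)
    (hζ : ∀ m, ζ m ∈ subdiff (fun y => -P.g m x y) (z m)) (hζp : ∀ m, ‖ζp m‖ ≤ B m)
    (hz' : ∀ m, IsProj (P.Z m) (z m - (δ * lam m) • ((2 : ℝ) • ζ m - ζp m)) (z' m))
    (hξ0 : ξ0 ∈ subdiff P.f0 x) (hξ : ∀ m, ξ m ∈ subdiff (fun y => P.g m y (z' m)) x)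
    (hx' : IsProj P.X ((α * γ / (α + γ)) •
      ((1 / α) • xk + (1 / γ) • x - (ξ0 + ∑ m, lam m • ξ m))) x') :
    P.innerGap α lam xk u v (x', z') + innerPotential γ δ lam u v x' z' ζ ≤
      innerPotential γ δ lam u v x z ζp + innerError D0 D B lam γ δ := by
  have hz'Z : ∀ m, z' m ∈ P.Z m := fun m => (hz' m).1
  have hprimal := hx'.prox_subgradient_step hP.X_convex hα hγ
    (isSubgradOn_innerLagrangian hP hlam hx hz'Z hξ0 hξ)
    (norm_innerLagrangian_subgrad_le hB hlam hx hz'Z hξ0 hξ)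
    (innerLagrangian_sub_le hP hB hlam hx'.1 hx hz'Z) hu
  have hdual := inner_dual_step hP hB hδ hlam hx hx'.1 hz hv hζ hζp hz'
  have hyoung := mul_sub_sq_le (2 * D0 + 4 * ∑ m, lam m * D m) ‖x' - x‖ hγ
  simp only [innerGap, innerObj_eq_innerLagrangian_add, innerPotential, innerError]
  linarith

theorem neg_le_innerPotential (hP : P.Standing) (hB : P.BoundedSubdiff D0 D B) (hγ : 0 ≤ γ)
    (hδ : 0 ≤ δ) (hlam : ∀ m, 0 ≤ lam m) (hz : ∀ m, z m ∈ P.Z m) (hv : ∀ m, v m ∈ P.Z m)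
    (hζ : ∀ m, ‖ζ m‖ ≤ B m) :
    -∑ m, lam m * (B m * Metric.diam (P.Z m)) ≤ innerPotential γ δ lam u v x z ζ := by
  rw [← Finset.sum_neg_distrib]
  refine le_add_of_nonneg_of_le (by positivity) (Finset.sum_le_sum fun m _ =>
    le_add_of_nonneg_of_le (by positivity) ?_)
  rw [← mul_neg]
  refine mul_le_mul_of_nonneg_left ?_ (hlam m)
  linarith [neg_mul_norm_le_inner_of_norm_le (b := z m - v m) (hζ m),
    mul_le_mul_of_nonneg_left (norm_sub_le_diam (hP.Z_compact m) (hz m) (hv m)) (hB.B_pos m).le]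

/-- An upper bound for the potential of the inner algorithm at its starting point. -/
noncomputable def innerPotentialBound (P : RobustProblem N M J) (B lam : Fin M → ℝ)
    (γ δ : ℝ) : ℝ :=
  1 / (2 * γ) * Metric.diam P.X ^ 2 +
    ∑ m, (1 / (2 * δ) * Metric.diam (P.Z m) ^ 2 + lam m * (B m * Metric.diam (P.Z m)))

theorem innerPotential_le (hP : P.Standing) (hB : P.BoundedSubdiff D0 D B) (hγ : 0 ≤ γ)
    (hδ : 0 ≤ δ) (hlam : ∀ m, 0 ≤ lam m) (hx : x ∈ P.X) (hu : u ∈ P.X)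
    (hz : ∀ m, z m ∈ P.Z m) (hv : ∀ m, v m ∈ P.Z m) (hζ : ∀ m, ‖ζ m‖ ≤ B m) :
    innerPotential γ δ lam u v x z ζ ≤ P.innerPotentialBound B lam γ δ := by
  have hux := norm_sub_le_diam hP.X_compact hu hx
  refine add_le_add (by gcongr) (Finset.sum_le_sum fun m _ => ?_)
  have hvz := norm_sub_le_diam (hP.Z_compact m) (hv m) (hz m)
  have hinner : inner ℝ (ζ m) (z m - v m) ≤ B m * Metric.diam (P.Z m) :=
    (inner_le_mul_norm_of_norm_le (hζ m)).trans (mul_le_mul_of_nonneg_left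
      (norm_sub_le_diam (hP.Z_compact m) (hz m) (hv m)) (hB.B_pos m).le)
  exact add_le_add (by gcongr) (mul_le_mul_of_nonneg_left hinner (hlam m))

section InnerLoop

open scoped Pointwise

variable {n : ℕ} {ζo : Option ((m : Fin M) → Vec (J m))} {sx : Vec N}
  {sz : (m : Fin M) → Vec (J m)}

/-- The invariant of the inner loop after `n` iterations. In `potential_le` the vector `ζ` plays
the role of the missing previous subgradient before the first iteration. -/
structure InnerInvariant (P : RobustProblem N M J) (D0 : ℝ) (D B : Fin M → ℝ) (α γ δ : ℝ)
    (lam : Fin M → ℝ) (xk : Vec N) (n : ℕ) (x : Vec N) (z : (m : Fin M) → Vec (J m))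
    (ζo : Option ((m : Fin M) → Vec (J m))) (sx : Vec N) (sz : (m : Fin M) → Vec (J m)) :
    Prop where
  x_mem : x ∈ P.X
  z_mem : ∀ m, z m ∈ P.Z m
  norm_le : ∀ ζ ∈ ζo, ∀ m, ‖ζ m‖ ≤ B m
  sum_mem : (sx, sz) ∈ (n : ℝ) • P.domain
  potential_le : ∀ ζ : (m : Fin M) → Vec (J m), (∀ m, ‖ζ m‖ ≤ B m) →
    ∀ u ∈ P.X, ∀ v : (m : Fin M) → Vec (J m), (∀ m, v m ∈ P.Z m) →
      perspective (P.innerGap α lam xk u v) n (sx, sz) +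
          innerPotential γ δ lam u v x z (ζo.getD ζ) ≤
        P.innerPotentialBound B lam γ δ + n * innerError D0 D B lam γ δ

theorem innerInvariant_zero (hP : P.Standing) (hB : P.BoundedSubdiff D0 D B) (hγ : 0 ≤ γ)
    (hδ : 0 ≤ δ) (hlam : ∀ m, 0 ≤ lam m) (hx : x ∈ P.X) (hz : ∀ m, z m ∈ P.Z m) :
    P.InnerInvariant D0 D B α γ δ lam xk 0 x z none 0 0 where
  x_mem := hx
  z_mem := hz
  norm_le := by simp
  sum_mem := zero_mem_natCast_zero_smul (domain_nonempty hP)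
  potential_le ζ hζ u hu v hv := by
    simpa [perspective_zero] using innerPotential_le hP hB hγ hδ hlam hx hu hz hv hζ

namespace InnerInvariant

theorem norm_getD_le (h : P.InnerInvariant D0 D B α γ δ lam xk n x z ζo sx sz)
    (hζ : ∀ m, ‖ζ m‖ ≤ B m) (m : Fin M) : ‖ζo.getD ζ m‖ ≤ B m := by
  cases hζo : ζo with
  | none => exact hζ m
  | some ζp => exact h.norm_le ζp hζo m

theorem step (h : P.InnerInvariant D0 D B α γ δ lam xk n x z ζo sx sz) (hP : P.Standing)
    (hB : P.BoundedSubdiff D0 D B) (hα : 0 < α) (hγ : 0 < γ) (hδ : 0 < δ)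
    (hlam : ∀ m, 0 ≤ lam m) (hζ : ∀ m, ζ m ∈ subdiff (fun y => -P.g m x y) (z m))
    (hz' : ∀ m, IsProj (P.Z m) (z m - (δ * lam m) • ((2 : ℝ) • ζ m - ζo.getD ζ m)) (z' m))
    (hξ0 : ξ0 ∈ subdiff P.f0 x) (hξ : ∀ m, ξ m ∈ subdiff (fun y => P.g m y (z' m)) x)
    (hx' : IsProj P.X ((α * γ / (α + γ)) •
      ((1 / α) • xk + (1 / γ) • x - (ξ0 + ∑ m, lam m • ξ m))) x') :
    P.InnerInvariant D0 D B α γ δ lam xk (n + 1) x' z' (some ζ) (sx + x') (sz + z') where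
  x_mem := hx'.1
  z_mem m := (hz' m).1
  norm_le ζ' hζ' m := by
    obtain rfl := Option.mem_some_iff.1 hζ'
    exact hB.gz_bound m x h.x_mem (z m) (h.z_mem m) (ζ m) (hζ m)
  sum_mem := by
    rw [← Prod.mk_add_mk]
    exact add_mem_natCast_succ_smul (convex_domain hP) h.sum_mem
      (mem_domain.2 ⟨hx'.1, fun m => (hz' m).1⟩)
  potential_le ζ' _ u hu v hv := by
    have hζB : ∀ m, ‖ζ m‖ ≤ B m := fun m =>
      hB.gz_bound m x h.x_mem (z m) (h.z_mem m) (ζ m) (hζ m)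
    have hadd := perspective_succ_le (convexOn_innerGap (xk := xk) hP hB hα.le hlam hu hv)
      h.sum_mem (x := (x', z')) (mem_domain.2 ⟨hx'.1, fun m => (hz' m).1⟩)
    have hstep := inner_step hP hB hα hγ hδ hlam h.x_mem hu h.z_mem hv hζ (h.norm_getD_le hζB)
      hz' hξ0 hξ hx'
    have hprev := h.potential_le ζ hζB u hu v hv
    rw [Option.getD_some, ← Prod.mk_add_mk, Nat.cast_succ]
    linarith

theorem perspective_innerGap_le (h : P.InnerInvariant D0 D B α γ δ lam xk n x z ζo sx sz)
    (hP : P.Standing) (hB : P.BoundedSubdiff D0 D B) (hγ : 0 ≤ γ) (hδ : 0 ≤ δ)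
    (hlam : ∀ m, 0 ≤ lam m) (hu : u ∈ P.X) (hv : ∀ m, v m ∈ P.Z m) :
    perspective (P.innerGap α lam xk u v) n (sx, sz) ≤
      P.innerPotentialBound B lam γ δ + ∑ m, lam m * (B m * Metric.diam (P.Z m)) +
        n * innerError D0 D B lam γ δ := by
  have hzero : ∀ m, ‖(0 : (m : Fin M) → Vec (J m)) m‖ ≤ B m := fun m => by
    simpa using (hB.B_pos m).le
  linarith [h.potential_le 0 hzero u hu v hv,
    neg_le_innerPotential (u := u) (x := x) hP hB hγ hδ hlam h.z_mem hv (h.norm_getD_le hzero)]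

end InnerInvariant

theorem innerLoop_ensures (hP : P.Standing) (hB : P.BoundedSubdiff D0 D B) (hα : 0 < α)
    (hγ : 0 < γ) (hδ : 0 < δ) (hlam : ∀ m, 0 ≤ lam m) (t : ℕ)
    (h : P.InnerInvariant D0 D B α γ δ lam xk n x z ζo sx sz) :
    (innerLoop α γ δ lam xk t x z ζo sx sz).Ensures P fun r c =>
      (∃ x z ζo, P.InnerInvariant D0 D B α γ δ lam xk (n + t) x z ζo r.1 r.2) ∧
        c = t * (3 * M + 2) := by
  induction t generalizing n x z ζo sx sz with
  | zero => exact ⟨⟨x, z, ζo, h⟩, (Nat.zero_mul _).symm⟩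
  | succ t ih =>
    refine ⟨fun m => hB.gz_nonempty m x h.x_mem (z m) (h.z_mem m), fun ζ hζ => ?_⟩
    refine ⟨fun m => exists_isProj (hP.Z_nonempty m) (hP.Z_compact m) _, fun z' hz' => ?_⟩
    refine ⟨fun _ => hB.f0_nonempty x h.x_mem, fun ξ0 hξ0 => ?_⟩
    refine ⟨fun m => hB.gx_nonempty m x h.x_mem (z' m) (hz' m).1, fun ξ hξ => ?_⟩
    refine ⟨fun _ => exists_isProj hP.X_nonempty hP.X_compact _, fun x' hx' => ?_⟩
    refine (ih (h.step hP hB hα hγ hδ hlam hζ hz' (hξ0 0) hξ (hx' 0))).mono ?_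
    rintro r c ⟨hr, rfl⟩
    refine ⟨by rwa [add_assoc, add_comm 1] at hr, ?_⟩
    simp only [Request.calls, Finset.sum_const, Finset.card_univ, Fintype.card_fin, smul_eq_mul]
    ring

end InnerLoop

/-- The constant in the `1 / √T` rate of the inner algorithm. -/
noncomputable def innerConst (P : RobustProblem N M J) (D0 : ℝ) (D B lam : Fin M → ℝ) : ℝ :=
  P.innerPotentialBound B lam 1 1 + ∑ m, lam m * (B m * Metric.diam (P.Z m)) +
    innerError D0 D B lam 1 1

theorem innerConst_pos (hB : P.BoundedSubdiff D0 D B) (hlam : ∀ m, 0 ≤ lam m) :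
    0 < P.innerConst D0 D B lam := by
  have hD0 := hB.D0_pos
  have hD := fun m => (hB.D_pos m).le
  have hB' := fun m => (hB.B_pos m).le
  have hdiam := fun m => Metric.diam_nonneg (s := P.Z m)
  have hlinear := Finset.sum_nonneg fun m (_ : m ∈ Finset.univ) => mul_nonneg (hlam m) (hD m)
  have hbias := fun m => mul_nonneg (hlam m) (mul_nonneg (hB' m) (hdiam m))
  have hbound : 0 ≤ P.innerPotentialBound B lam 1 1 :=
    add_nonneg (by positivity) (Finset.sum_nonneg fun m _ => add_nonneg (by positivity) (hbias m))
  have hsum := Finset.sum_nonneg fun m (_ : m ∈ Finset.univ) => hbias m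
  have herror : 0 < innerError D0 D B lam 1 1 :=
    add_pos_of_pos_of_nonneg (by positivity) (Finset.sum_nonneg fun m _ => by positivity)
  unfold innerConst
  linarith

theorem innerConst_mono (hB : P.BoundedSubdiff D0 D B) {lam' : Fin M → ℝ}
    (hlam : ∀ m, 0 ≤ lam m) (hle : ∀ m, lam m ≤ lam' m) :
    P.innerConst D0 D B lam ≤ P.innerConst D0 D B lam' := by
  have hD0 := hB.D0_pos.le
  have hD := fun m => (hB.D_pos m).le
  have hB' := fun m => (hB.B_pos m).le
  have hdiam := fun m => Metric.diam_nonneg (s := P.Z m)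
  have hlinear := Finset.sum_nonneg fun m (_ : m ∈ Finset.univ) => mul_nonneg (hlam m) (hD m)
  have hbias := fun m => mul_nonneg (hB' m) (hdiam m)
  have hdual := fun m => mul_nonneg (hlam m) (hB' m)
  unfold innerConst innerPotentialBound innerError
  gcongr with m _ m _ m _ m _ m _ <;> solve_by_elim

theorem innerPotentialBound_add_le_mul_innerConst (hB : P.BoundedSubdiff D0 D B)
    (hlam : ∀ m, 0 ≤ lam m) {s : ℝ} (hs : 1 ≤ s) :
    P.innerPotentialBound B lam (1 / s) (1 / s) + ∑ m, lam m * (B m * Metric.diam (P.Z m)) +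
      s ^ 2 * innerError D0 D B lam (1 / s) (1 / s) ≤ s * P.innerConst D0 D B lam := by
  have hbias := Finset.sum_nonneg fun m (_ : m ∈ Finset.univ) =>
    mul_nonneg (hlam m) (mul_nonneg (hB.B_pos m).le (Metric.diam_nonneg (s := P.Z m)))
  have hpot : P.innerPotentialBound B lam (1 / s) (1 / s) +
      (s - 1) * ∑ m, lam m * (B m * Metric.diam (P.Z m)) =
        s * P.innerPotentialBound B lam 1 1 := by
    simp only [innerPotentialBound, Finset.sum_add_distrib, ← Finset.mul_sum]
    field_simp
    ring
  have herr : s ^ 2 * innerError D0 D B lam (1 / s) (1 / s) =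
      s * innerError D0 D B lam 1 1 := by
    simp only [innerError, ← Finset.sum_mul]
    field_simp
  rw [herr, innerConst]
  linarith [mul_nonneg (sub_nonneg.2 hs) hbias]

theorem isStrongApproxSaddle_iff {ν : ℝ} :
    P.IsStrongApproxSaddle α ν lam xk x z ↔ (x, z) ∈ P.domain ∧
      ∀ u ∈ P.X, ∀ v, (∀ m, v m ∈ P.Z m) → P.innerGap α lam xk u v (x, z) ≤ ν := by
  rw [mem_domain, and_assoc]
  refine and_congr_right' (and_congr_right' (forall₄_congr fun u _ v _ => ?_))
  rw [innerGap, div_div, mul_comm α, ← sub_nonneg, ← sub_nonneg (b := _ + _)]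
  refine Iff.of_eq (congrArg _ ?_)
  ring

theorem innerAlg_ensures (hP : P.Standing) (hB : P.BoundedSubdiff D0 D B) (hα : 0 < α)
    (hlam : ∀ m, 0 ≤ lam m) {T : ℕ} (hT : 0 < T) {ν : ℝ}
    (hν : P.innerConst D0 D B lam / √T ≤ ν) (xk : Vec N) :
    (innerAlg T α (1 / √T) (1 / √T) lam xk).Ensures P fun r c =>
      P.IsStrongApproxSaddle α ν lam xk r.1 r.2 ∧ c = T * (3 * M + 2) := by
  obtain ⟨⟨x₀, z₀⟩, hstart⟩ := domain_nonempty hP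
  have hs : 1 ≤ √(T : ℝ) := Real.one_le_sqrt.2 (by exact_mod_cast hT)
  have hs0 : 0 < √(T : ℝ) := by linarith
  refine ⟨fun _ => ⟨(x₀, z₀), mem_domain.1 hstart⟩, fun s hs' => ?_⟩
  have hinit := innerInvariant_zero (α := α) (xk := xk) hP hB (one_div_pos.2 hs0).le
    (one_div_pos.2 hs0).le hlam (hs' 0).1 (hs' 0).2
  refine ((innerLoop_ensures hP hB hα (one_div_pos.2 hs0) (one_div_pos.2 hs0) hlam T
    hinit).mono ?_).bind
  rintro ⟨sx, sz⟩ _ ⟨⟨x, z, ζo, hinv⟩, rfl⟩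
  rw [zero_add] at hinv
  refine ⟨isStrongApproxSaddle_iff.2 ⟨?_, fun u hu v hv => le_trans ?_ hν⟩,
    by simp [Request.calls]⟩
  · rw [one_div]
    exact inv_natCast_smul_mem hT hinv.sum_mem
  · have hgap := hinv.perspective_innerGap_le hP hB (one_div_pos.2 hs0).le
      (one_div_pos.2 hs0).le hlam hu hv
    have hrate := innerPotentialBound_add_le_mul_innerConst (P := P) (D0 := D0) (D := D) hB hlam hs
    rw [Real.sq_sqrt (Nat.cast_nonneg T)] at hrate
    rw [le_div_iff₀ hs0, one_div]
    refine le_of_mul_le_mul_left ?_ hs0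
    calc √(T : ℝ) * (P.innerGap α lam xk u v ((T : ℝ)⁻¹ • sx, fun m => (T : ℝ)⁻¹ • sz m) * √T)
        = perspective (P.innerGap α lam xk u v) T (sx, sz) := by
          rw [mul_left_comm, Real.mul_self_sqrt (Nat.cast_nonneg T), mul_comm]; rfl
      _ ≤ √T * P.innerConst D0 D B lam := hgap.trans hrate

end RobustProblem

namespace RobustProblem

open scoped Pointwise

variable {N M : ℕ} {J : Fin M → ℕ} {P : RobustProblem N M J} {D0 : ℝ} {D B : Fin M → ℝ}
  {s θ : ℝ} {x : Vec N} {n : ℕ} {z z' ζ sz : (m : Fin M) → Vec (J m)}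

/-- The invariant of projected subgradient ascent after `n` iterations. -/
structure AscentInvariant (P : RobustProblem N M J) (B : Fin M → ℝ) (s : ℝ) (x : Vec N) (n : ℕ)
    (z sz : (m : Fin M) → Vec (J m)) : Prop where
  mem : ∀ m, z m ∈ P.Z m
  sum_mem : ∀ m, sz m ∈ (n : ℝ) • P.Z m
  potential_le : ∀ m, ∀ v ∈ P.Z m,
    perspective (fun z => -P.con m x z) n (sz m) + 1 / (2 * s) * ‖v - z m‖ ^ 2 ≤
      1 / (2 * s) * Metric.diam (P.Z m) ^ 2 + n * (B m ^ 2 * s / 2 - P.con m x v)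

theorem ascentInvariant_zero (hP : P.Standing) (hs : 0 ≤ s) (hz : ∀ m, z m ∈ P.Z m) :
    P.AscentInvariant B s x 0 z 0 where
  mem := hz
  sum_mem m := zero_mem_natCast_zero_smul (hP.Z_nonempty m)
  potential_le m v hv := by
    have hvz := norm_sub_le_diam (hP.Z_compact m) hv (hz m)
    rw [perspective_zero, Nat.cast_zero, zero_mul, zero_add, add_zero]
    gcongr

theorem AscentInvariant.step (h : P.AscentInvariant B s x n z sz) (hP : P.Standing)
    (hB : P.BoundedSubdiff D0 D B) (hs : 0 < s) (hx : x ∈ P.X)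
    (hζ : ∀ m, ζ m ∈ subdiff (fun y => -P.g m x y) (z m))
    (hz' : ∀ m, IsProj (P.Z m) (z m - s • ζ m) (z' m)) :
    P.AscentInvariant B s x (n + 1) z' (fun m => sz m + z m) where
  mem m := (hz' m).1
  sum_mem m := add_mem_natCast_succ_smul (hP.Z_convex m) (h.sum_mem m) (h.mem m)
  potential_le m v hv := by
    have hadd := perspective_succ_le (convexOn_neg_con hP hB hx) (h.sum_mem m) (h.mem m)
    have hstep := (hz' m).subgradient_step (hP.Z_convex m) hs
      (isSubgradOn_neg_con hP hx (h.mem m) (hζ m))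
      (hB.gz_bound m x hx (z m) (h.mem m) (ζ m) (hζ m)) hv
    push_cast
    linarith [h.potential_le m v hv]

theorem ascentLoop_ensures (hP : P.Standing) (hB : P.BoundedSubdiff D0 D B) (hs : 0 < s)
    (hx : x ∈ P.X) (t : ℕ) (h : P.AscentInvariant B s x n z sz) :
    (ascentLoop s x t z sz).Ensures P fun r c =>
      (∃ z, P.AscentInvariant B s x (n + t) z r) ∧ c = t * (2 * M) := by
  induction t generalizing n z sz with
  | zero => exact ⟨⟨z, h⟩, (Nat.zero_mul _).symm⟩
  | succ t ih =>
    refine ⟨fun m => hB.gz_nonempty m x hx (z m) (h.mem m), fun ζ hζ => ?_⟩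
    refine ⟨fun m => exists_isProj (hP.Z_nonempty m) (hP.Z_compact m) _, fun z' hz' => ?_⟩
    refine (ih (h.step hP hB hs hx hζ hz')).mono ?_
    rintro r c ⟨hr, rfl⟩
    refine ⟨by rwa [add_assoc, add_comm 1] at hr, ?_⟩
    simp only [Request.calls, Finset.sum_const, Finset.card_univ, Fintype.card_fin, smul_eq_mul]
    ring

/-- A constant for the `1 / √S` rate of projected subgradient ascent, common to all `m`. -/
noncomputable def ascentConst (P : RobustProblem N M J) (B : Fin M → ℝ) : ℝ :=
  1 + ∑ m, (Metric.diam (P.Z m) ^ 2 / 2 + B m ^ 2 / 2)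

theorem ascentConst_pos : 0 < P.ascentConst B := by
  unfold ascentConst
  positivity

theorem le_ascentConst (m : Fin M) :
    Metric.diam (P.Z m) ^ 2 / 2 + B m ^ 2 / 2 ≤ P.ascentConst B :=
  (Finset.single_le_sum (f := fun i => Metric.diam (P.Z i) ^ 2 / 2 + B i ^ 2 / 2)
    (fun i _ => by positivity) (Finset.mem_univ m)).trans
    (le_add_of_nonneg_left zero_le_one)

theorem AscentInvariant.isApproxMaximiser {S : ℕ} (h : P.AscentInvariant B (1 / √S) x S z sz)
    (hP : P.Standing) (hB : P.BoundedSubdiff D0 D B) (hS : 0 < S)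
    (hθ : P.ascentConst B / √S ≤ θ) (hx : x ∈ P.X) (m : Fin M) :
    P.IsApproxMaximiser θ x m ((S : ℝ)⁻¹ • sz m) := by
  have hroot : 0 < √(S : ℝ) := by positivity
  have hsq : √(S : ℝ) ^ 2 = S := Real.sq_sqrt (Nat.cast_nonneg S)
  obtain ⟨v, hv, hworst⟩ := exists_worstCon_eq hP hB m hx
  refine (isApproxMaximiser_iff hP hB hx (inv_natCast_smul_mem hS (h.sum_mem m)) θ).2 ?_
  rw [hworst, ← sub_le_iff_le_add']
  refine le_trans ?_ hθ
  rw [le_div_iff₀ hroot]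
  refine le_of_mul_le_mul_left ?_ hroot
  have hpot := h.potential_le m v hv
  have hdist : 0 ≤ 1 / (2 * (1 / √(S : ℝ))) * ‖v - z m‖ ^ 2 := by positivity
  have hrate : 1 / (2 * (1 / √(S : ℝ))) * Metric.diam (P.Z m) ^ 2 +
      S * (B m ^ 2 * (1 / √S) / 2) =
        √S * (Metric.diam (P.Z m) ^ 2 / 2 + B m ^ 2 / 2) := by
    rw [← hsq, Real.sqrt_sq hroot.le]
    field_simp
  rw [perspective] at hpot
  calc √(S : ℝ) * ((P.con m x v - P.con m x ((S : ℝ)⁻¹ • sz m)) * √S)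
      = S * (P.con m x v - P.con m x ((S : ℝ)⁻¹ • sz m)) := by
        rw [mul_left_comm, Real.mul_self_sqrt (Nat.cast_nonneg S), mul_comm]
    _ ≤ √S * (Metric.diam (P.Z m) ^ 2 / 2 + B m ^ 2 / 2) := by linarith
    _ ≤ √S * P.ascentConst B := by gcongr; exact le_ascentConst m

theorem findByAscent_ensures (hP : P.Standing) (hB : P.BoundedSubdiff D0 D B) {S : ℕ}
    (hS : 0 < S) (hθ : P.ascentConst B / √S ≤ θ) (hx : x ∈ P.X) :
    (findByAscent S (1 / √S) x).Ensures P fun z c =>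
      (∀ m, P.IsApproxMaximiser θ x m (z m)) ∧ c = S * (2 * M) := by
  obtain ⟨start, hstart⟩ := domain_nonempty hP
  have hs : 0 < 1 / √(S : ℝ) := by positivity
  refine ⟨fun _ => ⟨start, mem_domain.1 hstart⟩, fun s hs' => ?_⟩
  refine ((ascentLoop_ensures hP hB hs hx S
    (ascentInvariant_zero hP hs.le (hs' 0).2)).mono ?_).bind
  rintro sz _ ⟨⟨z, h⟩, rfl⟩
  rw [zero_add] at h
  refine ⟨fun m => ?_, by simp [Request.calls]⟩
  rw [one_div]
  exact h.isApproxMaximiser hP hB hS hθ hx m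

theorem findByPick_ensures (hP : P.Standing) (hB : P.BoundedSubdiff D0 D B) (hθ : 0 ≤ θ)
    (hx : x ∈ P.X) :
    (findByPick (J := J) θ x).Ensures P fun z c =>
      (∀ m, P.IsApproxMaximiser θ x m (z m)) ∧ c = 0 := by
  refine ⟨fun m => ?_, fun z hz => ⟨hz, by simp [Request.calls]⟩⟩
  obtain ⟨z, hz, hworst⟩ := exists_worstCon_eq hP hB m hx
  exact ⟨z, (isApproxMaximiser_iff hP hB hx hz θ).2 (hworst.le.trans (le_add_of_nonneg_right hθ))⟩

end RobustProblem

section Multipliers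

variable {β g gp g' w lam lam' μ c d Δ θ : ℝ}

theorem multiplier_step (hβ : 0 < β) (hμ : 0 ≤ μ) (hlam' : lam' = max (lam + β * g) 0) :
    g * (μ - lam') ≤
      1 / (2 * β) * ((μ - lam) ^ 2 - (μ - lam') ^ 2 - (lam' - lam) ^ 2) := by
  have hproj : (lam + β * g - lam') * (μ - lam') ≤ 0 := by
    rcases le_total 0 (lam + β * g) with h | h
    · rw [hlam', max_eq_left h, sub_self, zero_mul]
    · rw [hlam', max_eq_right h, sub_zero, sub_zero]
      exact mul_nonpos_of_nonpos_of_nonneg h hμ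
  rw [div_mul_eq_mul_div, le_div_iff₀ (by positivity)]
  linarith

theorem mul_le_abs_mul_add (hd : |d| ≤ c + θ) : Δ * d ≤ |Δ| * (c + θ) :=
  (le_abs_self _).trans ((abs_mul Δ d).trans_le (by gcongr))

theorem mul_le_half_sq_add (hβ : 0 < β) (hd : |d| ≤ c + θ) :
    Δ * d ≤ 1 / (2 * β) * Δ ^ 2 + β * c ^ 2 + β * θ ^ 2 := by
  have hsquares : 1 / (2 * β) * Δ ^ 2 + β * c ^ 2 + β * θ ^ 2 - |Δ| * (c + θ) =
      ((|Δ| - 2 * β * c) ^ 2 + (|Δ| - 2 * β * θ) ^ 2) / (4 * β) := by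
    rw [← sq_abs Δ]
    field_simp
    ring
  have hnonneg : 0 ≤ ((|Δ| - 2 * β * c) ^ 2 + (|Δ| - 2 * β * θ) ^ 2) / (4 * β) := by positivity
  linarith [mul_le_abs_mul_add (Δ := Δ) hd]

theorem mul_le_three_eighths_sq_add (hβ : 0 < β) (hd : |d| ≤ c + θ) :
    Δ * d ≤ 3 / (8 * β) * Δ ^ 2 + β * c ^ 2 + 2 * β * θ ^ 2 := by
  have hsquares : 3 / (8 * β) * Δ ^ 2 + β * c ^ 2 + 2 * β * θ ^ 2 - |Δ| * (c + θ) =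
      (2 * (|Δ| - 2 * β * c) ^ 2 + (|Δ| - 4 * β * θ) ^ 2) / (8 * β) := by
    rw [← sq_abs Δ]
    field_simp
    ring
  have hnonneg : 0 ≤ (2 * (|Δ| - 2 * β * c) ^ 2 + (|Δ| - 4 * β * θ) ^ 2) / (8 * β) := by
    positivity
  linarith [mul_le_abs_mul_add (Δ := Δ) hd]

theorem extrapolated_multiplier_step (hβ : 0 < β) (hμ : 0 ≤ μ) (hd : |g - gp| ≤ c + θ)
    (hlam' : lam' = max (lam + β * (2 * g - gp)) 0) (hle : g' ≤ w) (hge : w ≤ g' + θ) :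
    (μ - lam') * w + (1 / (2 * β) * (μ - lam') ^ 2 - (μ - lam') * (g' - g)) ≤
      1 / (2 * β) * (μ - lam) ^ 2 - (μ - lam) * (g - gp) + β * c ^ 2 +
        (θ * μ + β * θ ^ 2) := by
  have hlam'0 : 0 ≤ lam' := hlam' ▸ le_max_right _ _
  have hstep := multiplier_step hβ hμ hlam'
  have hyoung := mul_le_half_sq_add (Δ := lam' - lam) hβ hd
  have haccuracy := mul_le_mul_of_nonneg_left (sub_le_iff_le_add'.2 hge) hμ
  have hunder := mul_nonneg hlam'0 (sub_nonneg.2 hle)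
  linarith

end Multipliers

namespace RobustProblem

variable {N M : ℕ} {J : Fin M → ℕ}

/-- The Lagrangian of the robust problem. -/
noncomputable def lagrangian (P : RobustProblem N M J) (x : Vec N) (μ : Fin M → ℝ) : ℝ :=
  P.obj x + ∑ m, μ m * P.worstCon m x

/-- The values `gz m` underestimate the worst-case constraint functions at `x` by at most `θ`. -/
def IsApproxWorst (P : RobustProblem N M J) (θ : ℝ) (x : Vec N) (gz : Fin M → ℝ) : Prop :=
  ∀ m, gz m ≤ P.worstCon m x ∧ P.worstCon m x ≤ gz m + θ

/-- The potential of the outer algorithm with respect to the comparison point `(u, μ)`; `d` is the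
last change of the constraint values and `b` the length of the last primal step. -/
noncomputable def outerPotential (α β : ℝ) (u : Vec N) (μ : Fin M → ℝ) (x : Vec N)
    (lam : Fin M → ℝ) (b : ℝ) (d : Fin M → ℝ) : ℝ :=
  1 / (2 * α) * ‖u - x‖ ^ 2 + ∑ m, (1 / (2 * β) * (μ m - lam m) ^ 2 - (μ m - lam m) * d m) +
    1 / (2 * α) * b ^ 2

/-- The error made in one iteration of the outer algorithm. -/
noncomputable def outerError (β θ : ℝ) (μ : Fin M → ℝ) : ℝ :=
  θ + ∑ m, (θ * μ m + β * θ ^ 2)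

/-- A bound on the initial potential of the outer algorithm plus its accumulated errors, when the
accuracy `θ` is at most the reciprocal of the number of iterations. -/
noncomputable def outerBudget (P : RobustProblem N M J) (α β : ℝ) (μ : Fin M → ℝ) : ℝ :=
  1 / (2 * α) * Metric.diam P.X ^ 2 + ∑ m, (1 / (2 * β) * μ m ^ 2 + μ m + 3 * β) + 1

/-- A bound on the multipliers met by the outer algorithm, in terms of Lagrange multipliers `μ` of
the robust problem and a bound `A` on the constraint functions. -/
noncomputable def multiplierBound (P : RobustProblem N M J) (α β A : ℝ) (μ : Fin M → ℝ) : ℝ :=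
  ∑ m, μ m + √(8 * β * P.outerBudget α β μ) + β * (3 * A)

variable {P : RobustProblem N M J} {D0 : ℝ} {D B : Fin M → ℝ} {α β θ ν A : ℝ} {x x' u xs xk : Vec N}
  {lam lam' μ μ' gz gp gz' d : Fin M → ℝ} {z : (m : Fin M) → Vec (J m)}

theorem convexOn_lagrangian (hP : P.Standing) (hB : P.BoundedSubdiff D0 D B)
    (hμ : ∀ m, 0 ≤ μ m) : ConvexOn ℝ P.X fun x => P.lagrangian x μ :=
  (convexOn_obj hP hB).add (convexOn_finset_sum hP.X_convex _ fun m _ =>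
    (convexOn_worstCon hP hB m).smul (hμ m))

theorem IsFeasible.lagrangian_le_obj (hx : P.IsFeasible x) (hP : P.Standing)
    (hB : P.BoundedSubdiff D0 D B) (hμ : ∀ m, 0 ≤ μ m) : P.lagrangian x μ ≤ P.obj x :=
  add_le_of_nonpos_right (Finset.sum_nonpos fun m _ =>
    mul_nonpos_of_nonneg_of_nonpos (hμ m) ((isFeasible_iff hP hB hx.1).1 hx m))

theorem IsOptimal.exists_multipliers (hxs : P.IsOptimal xs) (hP : P.Standing)
    (hB : P.BoundedSubdiff D0 D B) :
    ∃ μ : Fin M → ℝ, (∀ m, 0 ≤ μ m) ∧ ∀ x ∈ P.X, P.obj xs ≤ P.lagrangian x μ := by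
  refine exists_multipliers_of_slater (convexOn_obj hP hB) (convexOn_worstCon hP hB) ?_
    fun x hx hcon => ?_
  · obtain ⟨xb, hxb, hslater⟩ := hP.slater
    refine ⟨xb, hxb, fun m => ?_⟩
    have hneg := hslater m
    rw [← coe_worstCon hP hB m hxb] at hneg
    exact_mod_cast hneg
  · have hle := hxs.2 x ((isFeasible_iff hP hB hx).2 hcon)
    rw [← coe_obj hP hx, ← coe_obj hP hxs.1.1] at hle
    exact_mod_cast hle

theorem IsStrongApproxSaddle.lagrangian_le (h : P.IsStrongApproxSaddle α ν lam xk x z)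
    (hP : P.Standing) (hB : P.BoundedSubdiff D0 D B) (hlam : ∀ m, 0 ≤ lam m) (hu : u ∈ P.X) :
    P.lagrangian x lam + 1 / (2 * α) * ‖x - xk‖ ^ 2 ≤ P.lagrangian u lam +
      1 / (2 * α) * ‖u - xk‖ ^ 2 - 1 / (2 * α) * ‖u - x‖ ^ 2 + ν := by
  obtain ⟨hx, hz, h⟩ := h
  choose v hv hworst using fun m => exists_worstCon_eq hP hB m hx
  have hsaddle := h u hu v hv
  have hworse : ∑ m, lam m * P.con m u (z m) ≤ ∑ m, lam m * P.worstCon m u :=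
    Finset.sum_le_sum fun m _ =>
      mul_le_mul_of_nonneg_left (con_le_worstCon hP hB hu (hz m)) (hlam m)
  rw [div_div, mul_comm α] at hsaddle
  simp only [innerObj] at hsaddle
  simp only [con] at hworse hworst
  simp only [lagrangian, obj, hworst]
  linarith

theorem isApproxWorst_con (hP : P.Standing) (hB : P.BoundedSubdiff D0 D B) (hx : x ∈ P.X)
    (hz : ∀ m, P.IsApproxMaximiser θ x m (z m)) :
    P.IsApproxWorst θ x fun m => P.con m x (z m) := fun m =>
  ⟨con_le_worstCon hP hB hx (hz m).1, (isApproxMaximiser_iff hP hB hx (hz m).1 θ).1 (hz m)⟩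

theorem isApproxWorst_worstCon (hθ : 0 ≤ θ) : P.IsApproxWorst θ x fun m => P.worstCon m x :=
  fun _ => ⟨le_rfl, le_add_of_nonneg_right hθ⟩

theorem IsApproxWorst.abs_sub_le (h' : P.IsApproxWorst θ x' gz') (h : P.IsApproxWorst θ x gz)
    (hP : P.Standing) (hB : P.BoundedSubdiff D0 D B) (hx : x ∈ P.X) (hx' : x' ∈ P.X)
    (m : Fin M) : |gz' m - gz m| ≤ D m * ‖x' - x‖ + θ := by
  have hup := worstCon_sub_le hP hB m hx' hx
  have hdown := worstCon_sub_le hP hB m hx hx'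
  rw [norm_sub_rev] at hdown
  obtain ⟨hle, hge⟩ := h m
  obtain ⟨hle', hge'⟩ := h' m
  exact abs_le.2 ⟨by linarith, by linarith⟩

theorem sum_mul_sq_le (hα : 0 < α) (hstep : 2 * α * β * ∑ m, D m ^ 2 ≤ 1) (b : ℝ) :
    ∑ m, β * (D m * b) ^ 2 ≤ 1 / (2 * α) * b ^ 2 := by
  have hsum : ∑ m, β * (D m * b) ^ 2 = (β * ∑ m, D m ^ 2) * b ^ 2 := by
    rw [Finset.mul_sum, Finset.sum_mul]
    exact Finset.sum_congr rfl fun m _ => by ring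
  rw [hsum]
  gcongr
  rw [le_div_iff₀ (by positivity)]
  linarith

theorem outer_step (hP : P.Standing) (hB : P.BoundedSubdiff D0 D B) (hα : 0 < α) (hβ : 0 < β)
    (hstep : 2 * α * β * ∑ m, D m ^ 2 ≤ 1) {b : ℝ} (hd : ∀ m, |gz m - gp m| ≤ D m * b + θ)
    (hlam' : ∀ m, lam' m = max (lam m + β * (2 * gz m - gp m)) 0)
    (hsaddle : P.IsStrongApproxSaddle α θ lam' x x' z) (hxs : P.IsFeasible xs)
    (hμ : ∀ m, 0 ≤ μ m) (hgz' : P.IsApproxWorst θ x' gz') :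
    P.lagrangian x' μ - P.obj xs + outerPotential α β xs μ x' lam' ‖x' - x‖ (gz' - gz) ≤
      outerPotential α β xs μ x lam b (gz - gp) + outerError β θ μ := by
  have hlam'0 : ∀ m, 0 ≤ lam' m := fun m => hlam' m ▸ le_max_right _ _
  have hprimal := hsaddle.lagrangian_le hP hB hlam'0 hxs.1
  have hfeas := hxs.lagrangian_le_obj hP hB hlam'0
  have hdual := Finset.sum_le_sum fun m (_ : m ∈ Finset.univ) =>
    extrapolated_multiplier_step hβ (hμ m) (hd m) (hlam' m) (hgz' m).1 (hgz' m).2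
  have hcoupling := sum_mul_sq_le hα hstep b
  rw [Finset.sum_add_distrib, Finset.sum_add_distrib, Finset.sum_add_distrib] at hdual
  simp only [sub_mul _ _ (P.worstCon _ _), Finset.sum_sub_distrib (f := fun m => μ m * _)] at hdual
  simp only [outerPotential, outerError, lagrangian, Pi.sub_apply] at hprimal hfeas ⊢
  linarith

theorem sum_le_outerPotential (hα : 0 < α) (hβ : 0 < β)
    (hstep : 2 * α * β * ∑ m, D m ^ 2 ≤ 1) {b : ℝ} (hd : ∀ m, |d m| ≤ D m * b + θ) :
    ∑ m, (1 / (8 * β) * (μ m - lam m) ^ 2 - 2 * β * θ ^ 2) ≤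
      outerPotential α β u μ x lam b d := by
  have hterm : ∀ m, 1 / (8 * β) * (μ m - lam m) ^ 2 - 2 * β * θ ^ 2 ≤
      1 / (2 * β) * (μ m - lam m) ^ 2 - (μ m - lam m) * d m + β * (D m * b) ^ 2 := fun m => by
    have hyoung := mul_le_three_eighths_sq_add (Δ := μ m - lam m) hβ (hd m)
    have hsplit : 1 / (2 * β) * (μ m - lam m) ^ 2 =
        1 / (8 * β) * (μ m - lam m) ^ 2 + 3 / (8 * β) * (μ m - lam m) ^ 2 := by
      field_simp
      ring
    linarith
  have hsum := Finset.sum_le_sum fun m (_ : m ∈ Finset.univ) => hterm m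
  have hcoupling := sum_mul_sq_le hα hstep b
  have hdist : 0 ≤ 1 / (2 * α) * ‖u - x‖ ^ 2 := by positivity
  rw [Finset.sum_add_distrib] at hsum
  rw [outerPotential]
  linarith

theorem outerBudget_mono (hβ : 0 < β) (hμ : ∀ m, 0 ≤ μ m) (hle : ∀ m, μ m ≤ μ' m) :
    P.outerBudget α β μ ≤ P.outerBudget α β μ' := by
  unfold outerBudget
  gcongr with m _ m _
  exacts [hμ m, hle m, hle m]

theorem outerBudget_pos (hα : 0 < α) (hβ : 0 < β) (hμ : ∀ m, 0 ≤ μ m) :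
    0 < P.outerBudget α β μ := by
  have hsum : 0 ≤ ∑ m, (1 / (2 * β) * μ m ^ 2 + μ m + 3 * β) := Finset.sum_nonneg fun m _ =>
    add_nonneg (add_nonneg (by positivity) (hμ m)) (by positivity)
  unfold outerBudget
  positivity

theorem multiplierBound_nonneg (hβ : 0 ≤ β) (hA : 0 ≤ A) (hμ : ∀ m, 0 ≤ μ m) :
    0 ≤ P.multiplierBound α β A μ := by
  have hsum := Finset.sum_nonneg fun m (_ : m ∈ Finset.univ) => hμ m
  unfold multiplierBound
  positivity

theorem initial_add_errors_le_outerBudget (hβ : 0 ≤ β) (hθ : 0 ≤ θ) (hθ1 : θ ≤ 1) {n : ℕ}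
    (hn : n * θ ≤ 1) (hμ : ∀ m, 0 ≤ μ m) :
    1 / (2 * α) * Metric.diam P.X ^ 2 + ∑ m, 1 / (2 * β) * μ m ^ 2 + n * outerError β θ μ +
      ∑ _m : Fin M, 2 * β * θ ^ 2 ≤ P.outerBudget α β μ := by
  have herror : n * outerError β θ μ ≤ 1 + ∑ m, (μ m + β) := by
    rw [outerError, mul_add, Finset.mul_sum]
    refine add_le_add hn (Finset.sum_le_sum fun m _ => ?_)
    have hlinear := mul_le_mul_of_nonneg_right hn (hμ m)
    have hquadratic : n * θ * (β * θ) ≤ 1 * (β * 1) :=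
      mul_le_mul hn (mul_le_mul_of_nonneg_left hθ1 hβ) (by positivity) zero_le_one
    linarith
  have hsq : ∑ _m : Fin M, 2 * β * θ ^ 2 ≤ ∑ _m : Fin M, 2 * β :=
    Finset.sum_le_sum fun _ _ => mul_le_of_le_one_right (by positivity) (pow_le_one₀ hθ hθ1)
  have hsplit : ∑ m, (1 / (2 * β) * μ m ^ 2 + μ m + 3 * β) =
      ∑ m, 1 / (2 * β) * μ m ^ 2 + ∑ m, (μ m + β) + ∑ _m : Fin M, 2 * β := by
    simp only [← Finset.sum_add_distrib]
    exact Finset.sum_congr rfl fun m _ => by ring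
  rw [outerBudget, hsplit]
  linarith

/-- `find` computes approximate maximisers of accuracy `θ` at every point of `X`, with at most `c`
oracle calls. -/
def FindsMaximisers (P : RobustProblem N M J) (θ : ℝ)
    (find : Vec N → Prog N M J ((m : Fin M) → Vec (J m))) (c : ℕ) : Prop :=
  ∀ x ∈ P.X, (find x).Ensures P fun z calls =>
    (∀ m, P.IsApproxMaximiser θ x m (z m)) ∧ calls ≤ c

/-- `inner` computes strong approximate saddle points of accuracy `ν` for all multipliers between
`0` and `Λ`, with at most `c` oracle calls. -/
def FindsSaddles (P : RobustProblem N M J) (α ν Λ : ℝ)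
    (inner : (Fin M → ℝ) → Vec N → Prog N M J (Vec N × ((m : Fin M) → Vec (J m)))) (c : ℕ) :
    Prop :=
  ∀ (lam : Fin M → ℝ) (x : Vec N), (∀ m, 0 ≤ lam m ∧ lam m ≤ Λ) →
    (inner lam x).Ensures P fun r calls => P.IsStrongApproxSaddle α ν lam x r.1 r.2 ∧ calls ≤ c

section OuterLoop

open scoped Pointwise

variable {n : ℕ} {gpo : Option (Fin M → ℝ)} {sx : Vec N} {b : ℝ}

/-- The invariant of the outer loop after `n` iterations. The constraint values at the current
point `x` are only computed in the next iteration, hence the quantification over `gz`, which also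
plays the role of the missing previous values before the first iteration. -/
structure OuterInvariant (P : RobustProblem N M J) (D : Fin M → ℝ) (α β θ A : ℝ) (xs : Vec N)
    (n : ℕ) (x : Vec N) (lam : Fin M → ℝ) (gpo : Option (Fin M → ℝ)) (sx : Vec N) (b : ℝ) :
    Prop where
  x_mem : x ∈ P.X
  sum_mem : sx ∈ (n : ℝ) • P.X
  abs_le : ∀ gp ∈ gpo, ∀ m, |gp m| ≤ A
  abs_sub_le : ∀ gz, P.IsApproxWorst θ x gz → ∀ m, |gz m - gpo.getD gz m| ≤ D m * b + θ
  potential_le : ∀ gz, P.IsApproxWorst θ x gz → ∀ μ : Fin M → ℝ, (∀ m, 0 ≤ μ m) →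
    perspective (fun y => P.lagrangian y μ - P.obj xs) n sx +
        outerPotential α β xs μ x lam b (gz - gpo.getD gz) ≤
      1 / (2 * α) * Metric.diam P.X ^ 2 + ∑ m, 1 / (2 * β) * μ m ^ 2 + n * outerError β θ μ

theorem outerInvariant_zero (hP : P.Standing) (hα : 0 ≤ α) (hθ : 0 ≤ θ) (hxs : xs ∈ P.X)
    (hx : x ∈ P.X) : P.OuterInvariant D α β θ A xs 0 x (fun _ => 0) none 0 0 where
  x_mem := hx
  sum_mem := zero_mem_natCast_zero_smul hP.X_nonempty
  abs_le := by simp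
  abs_sub_le gz _ m := by simpa using hθ
  potential_le gz _ μ _ := by
    have hdist := norm_sub_le_diam hP.X_compact hxs hx
    have hinit : 1 / (2 * α) * ‖xs - x‖ ^ 2 ≤ 1 / (2 * α) * Metric.diam P.X ^ 2 := by gcongr
    simpa [perspective_zero, outerPotential] using hinit

namespace OuterInvariant

theorem step (h : P.OuterInvariant D α β θ A xs n x lam gpo sx b) (hP : P.Standing)
    (hB : P.BoundedSubdiff D0 D B) (hα : 0 < α) (hβ : 0 < β)
    (hstep : 2 * α * β * ∑ m, D m ^ 2 ≤ 1) (hxs : P.IsFeasible xs)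
    (hgz : P.IsApproxWorst θ x gz) (hA : ∀ m, |gz m| ≤ A)
    (hlam' : ∀ m, lam' m = max (lam m + β * (2 * gz m - gpo.getD gz m)) 0)
    (hsaddle : P.IsStrongApproxSaddle α θ lam' x x' z) :
    P.OuterInvariant D α β θ A xs (n + 1) x' lam' (some gz) (sx + x') ‖x' - x‖ where
  x_mem := hsaddle.1
  sum_mem := add_mem_natCast_succ_smul hP.X_convex h.sum_mem hsaddle.1
  abs_le gp hgp := Option.mem_some_iff.1 hgp ▸ hA
  abs_sub_le gz' hgz' := hgz'.abs_sub_le hgz hP hB h.x_mem hsaddle.1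
  potential_le gz' hgz' μ hμ := by
    have hconvex : ConvexOn ℝ P.X fun y => P.lagrangian y μ - P.obj xs :=
      (convexOn_lagrangian hP hB hμ).add_const (-P.obj xs)
    have hadd := perspective_succ_le hconvex h.sum_mem hsaddle.1
    have hdecrease := outer_step hP hB hα hβ hstep (h.abs_sub_le gz hgz) hlam' hsaddle hxs hμ hgz'
    rw [Option.getD_some, Nat.cast_succ]
    linarith [h.potential_le gz hgz μ hμ]

theorem perspective_add_sum_le (h : P.OuterInvariant D α β θ A xs n x lam gpo sx b)
    (hα : 0 < α) (hβ : 0 < β) (hstep : 2 * α * β * ∑ m, D m ^ 2 ≤ 1) (hθ : 0 ≤ θ) (hθ1 : θ ≤ 1)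
    (hn : n * θ ≤ 1) (hμ : ∀ m, 0 ≤ μ m) :
    perspective (fun y => P.lagrangian y μ - P.obj xs) n sx +
      ∑ m, 1 / (8 * β) * (μ m - lam m) ^ 2 ≤ P.outerBudget α β μ := by
  have hexact := isApproxWorst_worstCon (P := P) (x := x) hθ
  have hpot := h.potential_le _ hexact μ hμ
  have hlower := sum_le_outerPotential (μ := μ) (lam := lam) (u := xs) (x := x) hα hβ hstep
    (h.abs_sub_le _ hexact)
  have hbudget := P.initial_add_errors_le_outerBudget (α := α) hβ.le hθ hθ1 hn hμ
  rw [Finset.sum_sub_distrib] at hlower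
  linarith!

theorem multiplier_add_le (h : P.OuterInvariant D α β θ A xs n x lam gpo sx b)
    (hα : 0 < α) (hβ : 0 < β) (hstep : 2 * α * β * ∑ m, D m ^ 2 ≤ 1) (hθ : 0 ≤ θ) (hθ1 : θ ≤ 1)
    (hn : n * θ ≤ 1) (hμ : ∀ m, 0 ≤ μ m) (hμs : ∀ x ∈ P.X, P.obj xs ≤ P.lagrangian x μ)
    (m : Fin M) : lam m + β * (3 * A) ≤ P.multiplierBound α β A μ := by
  have hnonneg : 0 ≤ perspective (fun y => P.lagrangian y μ - P.obj xs) n sx := by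
    rcases n.eq_zero_or_pos with rfl | hpos
    · rw [perspective_zero]
    · exact mul_nonneg (Nat.cast_nonneg n)
        (sub_nonneg.2 (hμs _ (inv_natCast_smul_mem hpos h.sum_mem)))
  have hterm : 1 / (8 * β) * (μ m - lam m) ^ 2 ≤ P.outerBudget α β μ :=
    (Finset.single_le_sum (f := fun m => 1 / (8 * β) * (μ m - lam m) ^ 2)
      (fun m _ => by positivity) (Finset.mem_univ m)).trans
      (by linarith [h.perspective_add_sum_le hα hβ hstep hθ hθ1 hn hμ])
  have hsq : (lam m - μ m) ^ 2 ≤ 8 * β * P.outerBudget α β μ := by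
    rw [div_mul_eq_mul_div, div_le_iff₀ (by positivity)] at hterm
    linarith
  have hroot := Real.le_sqrt_of_sq_le hsq
  have hsingle := Finset.single_le_sum (f := μ) (fun m _ => hμ m) (Finset.mem_univ m)
  rw [multiplierBound]
  linarith

end OuterInvariant

theorem multiplier_update_le {l g gp Λ : ℝ} (hβ : 0 ≤ β) (hg : |g| ≤ A) (hgp : |gp| ≤ A)
    (hl : l + β * (3 * A) ≤ Λ) (hΛ : 0 ≤ Λ) : max (l + β * (2 * g - gp)) 0 ≤ Λ := by
  have hle : 2 * g - gp ≤ 3 * A := by linarith [(abs_le.1 hg).2, (abs_le.1 hgp).1]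
  exact max_le (by linarith [mul_le_mul_of_nonneg_left hle hβ]) hΛ

theorem outerLoop_ensures (hP : P.Standing) (hB : P.BoundedSubdiff D0 D B) (hα : 0 < α)
    (hβ : 0 < β) (hstep : 2 * α * β * ∑ m, D m ^ 2 ≤ 1) (hA0 : 0 ≤ A)
    (hA : ∀ m, ∀ x ∈ P.X, ∀ z ∈ P.Z m, |P.con m x z| ≤ A) (hxs : P.IsFeasible xs)
    (hμ : ∀ m, 0 ≤ μ m) (hμs : ∀ x ∈ P.X, P.obj xs ≤ P.lagrangian x μ) (hθ : 0 ≤ θ)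
    (hθ1 : θ ≤ 1) {find : Vec N → Prog N M J ((m : Fin M) → Vec (J m))}
    {inner : (Fin M → ℝ) → Vec N → Prog N M J (Vec N × ((m : Fin M) → Vec (J m)))} {cf ci : ℕ}
    (hfind : P.FindsMaximisers θ find cf)
    (hinner : P.FindsSaddles α θ (P.multiplierBound α β A μ) inner ci) (j : ℕ)
    (hn : ((n + j : ℕ) : ℝ) * θ ≤ 1) (h : P.OuterInvariant D α β θ A xs n x lam gpo sx b) :
    (outerLoop P α β θ θ find inner j x lam gpo sx).Ensures P fun s c =>
      (∃ x lam gpo b, P.OuterInvariant D α β θ A xs (n + j) x lam gpo s b) ∧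
        c ≤ j * (cf + ci) := by
  induction j generalizing n x lam gpo sx b with
  | zero => exact ⟨⟨x, lam, gpo, b, h⟩, Nat.zero_le _⟩
  | succ j ih =>
    refine ((hfind x h.x_mem).mono ?_).bind
    rintro z c₁ ⟨hz, hc₁⟩
    refine ⟨hz, ?_⟩
    have hgzA : ∀ m, |P.con m x (z m)| ≤ A := fun m => hA m x h.x_mem (z m) (hz m).1
    have hgpA : ∀ m, |gpo.getD (fun m => P.con m x (z m)) m| ≤ A := by
      cases hgpo : gpo with
      | none => exact hgzA
      | some gp => exact h.abs_le gp hgpo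
    have hnθ : (n : ℝ) * θ ≤ 1 :=
      (mul_le_mul_of_nonneg_right (Nat.cast_le.2 (Nat.le_add_right n _)) hθ).trans hn
    have hlam := h.multiplier_add_le hα hβ hstep hθ hθ1 hnθ hμ hμs
    refine ((hinner _ x fun m => ⟨le_max_right _ _, multiplier_update_le hβ.le (hgzA m) (hgpA m)
      (hlam m) (multiplierBound_nonneg hβ.le hA0 hμ)⟩).mono ?_).bind
    rintro r c₂ ⟨hr, hc₂⟩
    refine ⟨hr, ?_⟩
    have hnext := h.step hP hB hα hβ hstep hxs (isApproxWorst_con hP hB h.x_mem hz) hgzA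
      (fun _ => rfl) hr
    rw [← add_assoc, add_right_comm] at hn ⊢
    refine (ih hn hnext).mono ?_
    rintro s c₃ ⟨hs, hc₃⟩
    refine ⟨hs, ?_⟩
    rw [Nat.succ_mul]
    lia

end OuterLoop

theorem isApproxOptimal_of_lagrangian_le {ε : ℝ} (hP : P.Standing) (hB : P.BoundedSubdiff D0 D B)
    (hxs : P.IsOptimal xs) (hμ : ∀ m, 0 ≤ μ m) (hμs : ∀ x ∈ P.X, P.obj xs ≤ P.lagrangian x μ)
    (hx : x ∈ P.X) (hε : ∀ μ' : Fin M → ℝ, (∀ m, 0 ≤ μ' m) → (∀ m, μ' m ≤ μ m + 1) →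
      P.lagrangian x μ' - P.obj xs ≤ ε) : P.IsApproxOptimal ε x := by
  have hε0 : 0 ≤ ε :=
    (sub_nonneg.2 (hμs x hx)).trans (hε μ hμ fun m => le_add_of_nonneg_right zero_le_one)
  refine ⟨hx, ⟨xs, hxs, ?_⟩, fun m => max_le ?_ (by exact_mod_cast hε0)⟩
  · have hzero := hε 0 (fun _ => le_rfl) fun m => add_nonneg (hμ m) zero_le_one
    have hobj : P.obj x ≤ P.obj xs + ε := by
      simpa [lagrangian, add_comm] using hzero
    rw [← coe_obj hP hx, ← coe_obj hP hxs.1.1]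
    exact_mod_cast hobj
  · have hsingle : ∀ i, (0 : ℝ) ≤ (Pi.single m 1 : Fin M → ℝ) i ∧
        (Pi.single m 1 : Fin M → ℝ) i ≤ 1 := fun i => by
      rcases eq_or_ne i m with rfl | h <;> simp [*]
    have hshift := hε (μ + Pi.single m 1) (fun i => add_nonneg (hμ i) (hsingle i).1)
      fun i => by simpa using (hsingle i).2
    have hexpand : P.lagrangian x (μ + Pi.single m 1) = P.lagrangian x μ + P.worstCon m x := by
      simp [lagrangian, add_mul, Finset.sum_add_distrib, Pi.single_apply, add_assoc]
    have hviolation : P.worstCon m x ≤ ε := by linarith [hμs x hx]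
    rw [← coe_worstCon hP hB m hx]
    exact_mod_cast hviolation

theorem OuterInvariant.isApproxOptimal {K : ℕ} {gpo : Option (Fin M → ℝ)} {sx : Vec N} {b ε : ℝ}
    (h : P.OuterInvariant D α β θ A xs K x lam gpo sx b) (hP : P.Standing)
    (hB : P.BoundedSubdiff D0 D B) (hα : 0 < α) (hβ : 0 < β)
    (hstep : 2 * α * β * ∑ m, D m ^ 2 ≤ 1) (hθ : 0 ≤ θ) (hθ1 : θ ≤ 1) (hK : 0 < K)
    (hKθ : K * θ ≤ 1) (hxs : P.IsOptimal xs) (hμ : ∀ m, 0 ≤ μ m)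
    (hμs : ∀ x ∈ P.X, P.obj xs ≤ P.lagrangian x μ) (hε : P.outerBudget α β (μ + 1) / K ≤ ε) :
    P.IsApproxOptimal ε ((K : ℝ)⁻¹ • sx) := by
  refine isApproxOptimal_of_lagrangian_le hP hB hxs hμ hμs (inv_natCast_smul_mem hK h.sum_mem)
    fun μ' hμ' hle => le_trans ?_ hε
  have hdist : 0 ≤ ∑ m, 1 / (8 * β) * (μ' m - lam m) ^ 2 :=
    Finset.sum_nonneg fun m _ => by positivity
  have hgap := h.perspective_add_sum_le hα hβ hstep hθ hθ1 hKθ hμ'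
  have hbudget : P.outerBudget α β μ' ≤ P.outerBudget α β (μ + 1) := outerBudget_mono hβ hμ' hle
  rw [perspective] at hgap
  rw [le_div_iff₀' (by exact_mod_cast hK)]
  linarith

theorem proM3_ensures (hP : P.Standing) (hB : P.BoundedSubdiff D0 D B) (hα : 0 < α) (hβ : 0 < β)
    (hstep : 2 * α * β * ∑ m, D m ^ 2 ≤ 1) (hA0 : 0 ≤ A)
    (hA : ∀ m, ∀ x ∈ P.X, ∀ z ∈ P.Z m, |P.con m x z| ≤ A) (hxs : P.IsOptimal xs)
    (hμ : ∀ m, 0 ≤ μ m) (hμs : ∀ x ∈ P.X, P.obj xs ≤ P.lagrangian x μ) {K T : ℕ} (hK : 0 < K)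
    {find : Vec N → Prog N M J ((m : Fin M) → Vec (J m))} {cf ci : ℕ} {γ δ ε : ℝ}
    (hfind : P.FindsMaximisers (1 / K) find cf)
    (hinner : P.FindsSaddles α (1 / K) (P.multiplierBound α β A μ) (innerAlg T α γ δ) ci)
    (hε : P.outerBudget α β (μ + 1) / K ≤ ε) {x0 : Vec N} (hx0 : x0 ∈ P.X) :
    (proM3 P α β (1 / K) (1 / K) find K T γ δ x0).Ensures P fun x c =>
      P.IsApproxOptimal ε x ∧ c ≤ K * (cf + ci) := by
  have hKr : (1 : ℝ) ≤ K := by exact_mod_cast hK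
  have hθ : (0 : ℝ) ≤ 1 / K := by positivity
  have hθ1 : (1 : ℝ) / K ≤ 1 := div_le_one_of_le₀ hKr (by linarith)
  have hKθ : (K : ℝ) * (1 / K) ≤ 1 := (mul_one_div_cancel (by linarith)).le
  have hinit := outerInvariant_zero (D := D) (β := β) (A := A) hP hα.le hθ hxs.1.1 hx0
  refine ((outerLoop_ensures hP hB hα hβ hstep hA0 hA hxs.1 hμ hμs hθ hθ1 hfind hinner K
    (by rwa [zero_add]) hinit).mono ?_).bind
  rintro s c ⟨⟨x, lam, gpo, b, h⟩, hc⟩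
  rw [zero_add] at h
  refine ⟨?_, hc⟩
  rw [one_div]
  exact h.isApproxOptimal hP hB hα hβ hstep hθ hθ1 hK hKθ hxs hμ hμs hε

theorem findsMaximisers_of_rule (hP : P.Standing) (hB : P.BoundedSubdiff D0 D B) (hθ : 0 ≤ θ)
    {S : ℕ} (hS : 0 < S) (hSθ : P.ascentConst B / √S ≤ θ)
    {find : Vec N → Prog N M J ((m : Fin M) → Vec (J m))}
    (hfind : find = findByPick θ ∨ find = findByAscent S (1 / √S)) :
    P.FindsMaximisers θ find (S * (2 * M)) := by
  intro x hx
  rcases hfind with rfl | rfl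
  · exact (findByPick_ensures hP hB hθ hx).mono fun _ _ h => ⟨h.1, h.2.le.trans (Nat.zero_le _)⟩
  · exact (findByAscent_ensures hP hB hS hSθ hx).mono fun _ _ h => ⟨h.1, h.2.le⟩

theorem findsSaddles_innerAlg (hP : P.Standing) (hB : P.BoundedSubdiff D0 D B) (hα : 0 < α)
    {Λ : ℝ} {T : ℕ} (hT : 0 < T) (hν : P.innerConst D0 D B (fun _ => Λ) / √T ≤ ν) :
    P.FindsSaddles α ν Λ (innerAlg T α (1 / √T) (1 / √T)) (T * (3 * M + 2)) := by
  intro lam x hlam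
  have hconst : P.innerConst D0 D B lam ≤ P.innerConst D0 D B fun _ => Λ :=
    innerConst_mono hB (fun m => (hlam m).1) fun m => (hlam m).2
  have hrate : P.innerConst D0 D B lam / √T ≤ ν := le_trans (by gcongr) hν
  exact (innerAlg_ensures hP hB hα (fun m => (hlam m).1) hT hrate x).mono
    fun _ _ h => ⟨h.1, h.2.le⟩

end RobustProblem

theorem div_sqrt_ceil_sq_mul_sq_le {a : ℝ} (ha : 0 < a) {K : ℕ} (hK : 0 < K) :
    a / √⌈a ^ 2 * (K : ℝ) ^ 2⌉₊ ≤ 1 / K := by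
  have hroot : a * K ≤ √⌈a ^ 2 * (K : ℝ) ^ 2⌉₊ :=
    Real.le_sqrt_of_sq_le ((mul_pow a _ 2).trans_le (Nat.le_ceil _))
  calc a / √⌈a ^ 2 * (K : ℝ) ^ 2⌉₊ ≤ a / (a * K) := by gcongr
    _ = 1 / K := by field_simp

theorem ceil_div_le_mul_max {c ε : ℝ} (hc : 0 ≤ c) (hε : 0 < ε) :
    (⌈c / ε⌉₊ : ℝ) ≤ (c + 1) * max 1 (1 / ε) := by
  have hceil := (Nat.ceil_lt_add_one (div_nonneg hc hε.le)).le
  have hmax := mul_le_mul_of_nonneg_left (le_max_right 1 (1 / ε)) hc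
  rw [mul_one_div] at hmax
  linarith [le_max_left 1 (1 / ε)]

theorem ceil_mul_sq_le {c : ℝ} (hc : 0 ≤ c) {K : ℕ} (hK : 0 < K) :
    (⌈c * (K : ℝ) ^ 2⌉₊ : ℝ) ≤ (c + 1) * (K : ℝ) ^ 2 := by
  have hceil := (Nat.ceil_lt_add_one (show 0 ≤ c * (K : ℝ) ^ 2 by positivity)).le
  have hone : (1 : ℝ) ≤ (K : ℝ) ^ 2 := one_le_pow₀ (by exact_mod_cast hK)
  linarith

theorem max_one_pow {R : Type*} [Semiring R] [LinearOrder R] [IsStrictOrderedRing R] {a : R}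
    (ha : 0 ≤ a) (n : ℕ) : max 1 a ^ n = max 1 (a ^ n) := by
  rcases le_total 1 a with h | h
  · rw [max_eq_right h, max_eq_right (one_le_pow₀ h)]
  · rw [max_eq_left h, max_eq_left (pow_le_one₀ ha h), one_pow]

theorem total_calls_le {cK cT cS ε p q : ℝ} (hcK : 0 < cK) (hcT : 0 ≤ cT) (hcS : 0 ≤ cS)
    (hε : 0 < ε) (hp : 0 ≤ p) (hq : 0 ≤ q) {K : ℕ} (hK : K = ⌈cK / ε⌉₊) :
    K * (⌈cS * (K : ℝ) ^ 2⌉₊ * p + ⌈cT * (K : ℝ) ^ 2⌉₊ * q) ≤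
      ((cS + 1) * p + (cT + 1) * q) * (cK + 1) ^ 3 * max 1 (1 / ε ^ 3) := by
  have hKpos : 0 < K := hK ▸ Nat.ceil_pos.2 (div_pos hcK hε)
  have hKle : (K : ℝ) ≤ (cK + 1) * max 1 (1 / ε) := hK ▸ ceil_div_le_mul_max hcK.le hε
  calc K * (⌈cS * (K : ℝ) ^ 2⌉₊ * p + ⌈cT * (K : ℝ) ^ 2⌉₊ * q)
      ≤ K * ((cS + 1) * (K : ℝ) ^ 2 * p + (cT + 1) * (K : ℝ) ^ 2 * q) := by
        gcongr
        exacts [ceil_mul_sq_le hcS hKpos, ceil_mul_sq_le hcT hKpos]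
    _ = ((cS + 1) * p + (cT + 1) * q) * (K : ℝ) ^ 3 := by ring
    _ ≤ ((cS + 1) * p + (cT + 1) * q) * ((cK + 1) * max 1 (1 / ε)) ^ 3 := by gcongr
    _ = ((cS + 1) * p + (cT + 1) * q) * (cK + 1) ^ 3 * max 1 (1 / ε ^ 3) := by
        rw [mul_pow, max_one_pow (by positivity), one_div_pow, mul_assoc]

theorem two_mul_mul_mul_le_one {α β s : ℝ} (hβ : 0 ≤ β) (hs : 0 ≤ s) (hαs : α * √s ≤ 1)
    (hβs : 2 * β * √s ≤ 1) : 2 * α * β * s ≤ 1 := by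
  calc 2 * α * β * s = α * √s * (2 * β * √s) := by
        linear_combination (-(2 * α * β)) * Real.mul_self_sqrt hs
    _ ≤ 1 := mul_le_one₀ hαs (by positivity) hβs

theorem mainTheorem1_general {N M : ℕ} {J : Fin M → ℕ} (P : RobustProblem N M J)
    (hP : P.Standing) (D0 : ℝ) (D B : Fin M → ℝ) (hB : P.BoundedSubdiff D0 D B)
    (α β : ℝ) (hα : 0 < α) (hβ : 0 < β) (hstep : 2 * α * β * ∑ m, D m ^ 2 ≤ 1) :
    ∃ cK cT cS C : ℝ, 0 < cK ∧ 0 < cT ∧ 0 < cS ∧ 0 < C ∧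
      ∀ ε : ℝ, 0 < ε → ∀ K T S : ℕ,
        K = ⌈cK / ε⌉₊ → T = ⌈cT * (K : ℝ) ^ 2⌉₊ → S = ⌈cS * (K : ℝ) ^ 2⌉₊ →
        ∀ find : Vec N → Prog N M J ((m : Fin M) → Vec (J m)),
          (find = findByPick (1 / K) ∨ find = findByAscent S (1 / √S)) →
          ∀ x0 ∈ P.X,
            (proM3 P α β (1 / K) (1 / K) find K T (1 / √T) (1 / √T) x0).Ensures P
              fun x calls =>
                P.IsApproxOptimal ε x ∧ (calls : ℝ) ≤ C * max 1 (1 / ε ^ 3) := by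
  obtain ⟨xs, hxs⟩ := hP.optimum
  obtain ⟨μ, hμ, hμs⟩ := hxs.exists_multipliers hP hB
  obtain ⟨A, hA0, hA⟩ := RobustProblem.exists_forall_abs_con_le hP hB
  set cK := P.outerBudget α β (μ + 1)
  set a := P.innerConst D0 D B fun _ => P.multiplierBound α β A μ
  set e := P.ascentConst B
  have hcK : 0 < cK := RobustProblem.outerBudget_pos hα hβ fun m => add_nonneg (hμ m) zero_le_one
  have ha : 0 < a :=
    RobustProblem.innerConst_pos hB fun _ => RobustProblem.multiplierBound_nonneg hβ.le hA0 hμ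
  have he : 0 < e := RobustProblem.ascentConst_pos
  refine ⟨cK, a ^ 2, e ^ 2, ((e ^ 2 + 1) * (2 * M) + (a ^ 2 + 1) * (3 * M + 2)) * (cK + 1) ^ 3,
    hcK, by positivity, by positivity, by positivity, ?_⟩
  rintro ε hε K _ _ hK rfl rfl find hfind x0 hx0
  have hKpos : 0 < K := hK ▸ Nat.ceil_pos.2 (div_pos hcK hε)
  have hKε : cK / K ≤ ε := div_le_of_le_mul₀ (by positivity) hε.le
    ((div_le_iff₀' hε).1 (hK ▸ Nat.le_ceil _))
  have hfinds := RobustProblem.findsMaximisers_of_rule hP hB (by positivity)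
    (Nat.ceil_pos.2 (by positivity)) (div_sqrt_ceil_sq_mul_sq_le he hKpos) hfind
  have hinner := RobustProblem.findsSaddles_innerAlg hP hB hα (Nat.ceil_pos.2 (by positivity))
    (div_sqrt_ceil_sq_mul_sq_le ha hKpos)
  refine (RobustProblem.proM3_ensures hP hB hα hβ hstep hA0 hA hxs hμ hμs hKpos hfinds hinner hKε
    hx0).mono fun x c h => ⟨h.1, le_trans ?_ (total_calls_le hcK (sq_nonneg a) (sq_nonneg e) hε
      (by positivity) (by positivity) hK)⟩
  exact_mod_cast h.2

theorem mainTheorem1 {N M : ℕ} {J : Fin M → ℕ} (P : RobustProblem N M J)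
    (hP : P.Standing) (D0 : ℝ) (D B : Fin M → ℝ) (hB : P.BoundedSubdiff D0 D B)
    (α β : ℝ) (hα : 0 < α) (hβ : 0 < β)
    (hαD : α * √(∑ m, D m ^ 2) ≤ 1) (hβD : 2 * β * √(∑ m, D m ^ 2) ≤ 1) :
    ∃ cK cT cS C : ℝ, 0 < cK ∧ 0 < cT ∧ 0 < cS ∧ 0 < C ∧
      ∀ ε : ℝ, 0 < ε → ∀ K T S : ℕ,
        K = ⌈cK / ε⌉₊ → T = ⌈cT * (K : ℝ) ^ 2⌉₊ → S = ⌈cS * (K : ℝ) ^ 2⌉₊ →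
        ∀ find : Vec N → Prog N M J ((m : Fin M) → Vec (J m)),
          (find = findByPick (1 / K) ∨ find = findByAscent S (1 / √S)) →
          ∀ x0 ∈ P.X,
            (proM3 P α β (1 / K) (1 / K) find K T (1 / √T) (1 / √T) x0).Ensures P
              fun x calls =>
                P.IsApproxOptimal ε x ∧ (calls : ℝ) ≤ C * max 1 (1 / ε ^ 3) :=
  mainTheorem1_general P hP D0 D B hB α β hα hβ
    (two_mul_mul_mul_le_one hβ.le (Finset.sum_nonneg fun m _ => sq_nonneg (D m)) hαD hβD)
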